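/- Let $V\subset\mathbb C^N$ be an algebraic subvariety (the common zero set of a family of polynomials, not necessarily irreducible), let $X$ be its closure in $\mathbb P^N$, and put $X_\infty=X\setminus V$, where $\mathbb C^N=\{z_0\neq 0\}\subset\mathbb P^N$. Let $F_1,\dots,F_m\in\mathbb C[x_1,\dots,x_N]$. Let $\hat f_j=z_0^{\deg F_j}F_j(z_1/z_0,\dots,z_N/z_0)$ be the homogenization of $F_j$, let $f_j$ be the section of $\mathcal O(\deg F_j)|_X$ that it induces, and let $\mathcal J_f\subset\mathcal O_X$ be the ideal sheaf generated by $f_1,\dots,f_m$. We say that $\mathcal J_f$ has an associated variety contained in $X_\infty$ if for some $x\in X_\infty$ the ideal $(\mathcal J_f)_x$ of the local ring $\mathcal O_{X,x}$ has an associated prime $\mathfrak p$ with $V(\mathfrak p)\subset X_\infty$. A polynomial $\Phi$ is said to be in the ideal $(F_j)$ on $V$ if there are polynomials $Q_j$ such that $$F_1Q_1+\cdots+F_mQ_m=\Phi\quad\text{on } V. \qquad (1)$$ (i) Assume that $\mathcal J_f$ has no associated variety contained in $X_\infty$. Then there is a constant $\beta=\beta(X,F_1,\dots,F_m)$ such that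 every polynomial $\Phi$ in the ideal $(F_j)$ on $V$ has a representation (1) with polynomials $Q_j$ satisfying $$\deg(F_jQ_j)\le\max(\deg\Phi,\beta),\qquad j=1,\dots,m. \qquad (2)$$ If $V=\mathbb C^N$, one can take $\beta=\operatorname{reg}J_f$, where $J_f=(\hat f_1,\dots,\hat f_m)\subset\mathbb C[z_0,\dots,z_N]$ is the homogeneous ideal generated by the homogenizations, and $\operatorname{reg}J_f$ is its Castelnuovo–Mumford regularity: $\max_{k,i}(d^i_k-k)$ for a minimal graded free resolution $\cdots\to\bigoplus_i S(-d_1^i)\to\bigoplus_i S(-d_0^i)\to J_f\to0$ over $S=\mathbb C[z_0,\dots,z_N]$ (if $J_f=0$, put $\operatorname{reg}J_f=0$). (ii) Conversely, if $\mathcal J_f$ has an associated variety contained in $X_\infty$, then there is no constant $\beta$ such that every $\Phi$ in the ideal $(F_j)$ on $V$ has a representation (1) satisfying (2). -/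

import Mathlib

open MvPolynomial

attribute [local instance] MvPolynomial.gradedAlgebra

namespace DivisionProblem

/-! ## Affine and projective sets -/

/-- `V ⊆ ℂᴺ` is algebraic: the common zero set of a set of polynomials. -/
def IsAlgebraicSet {N : ℕ} (V : Set (Fin N → ℂ)) : Prop :=
  ∃ A : Set (MvPolynomial (Fin N) ℂ), V = {v | ∀ p ∈ A, eval v p = 0}

/-- Complex projective space `ℙᴺ`, with homogeneous coordinates `z₀, …, z_N`. -/
abbrev PN (N : ℕ) : Type := Projectivization ℂ (Fin (N + 1) → ℂ)

/-- The homogeneous coordinate ring `ℂ[z₀, …, z_N]`. -/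
abbrev HomPoly (N : ℕ) : Type := MvPolynomial (Fin (N + 1)) ℂ

/-- The forms of degree `d` in `ℂ[z₀, …, z_N]`. -/
abbrev forms (N : ℕ) : ℕ → Submodule ℂ (HomPoly N) := homogeneousSubmodule (Fin (N + 1)) ℂ

/-- The standard embedding `ℂᴺ → ℙᴺ`, `v ↦ [1 : v₁ : … : v_N]`. -/
noncomputable def embed {N : ℕ} (v : Fin N → ℂ) : PN N :=
  Projectivization.mk ℂ (Fin.cons 1 v : Fin (N + 1) → ℂ)
    (fun h => one_ne_zero (congrFun h 0))

/-- Evaluation of `p` at a representative of the point `x`. For a form `p`, whether this is zero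
does not depend on the representative. -/
noncomputable def evalAt {N : ℕ} (x : PN N) (p : HomPoly N) : ℂ := eval x.rep p

/-- The closure `X` of `V` in `ℙᴺ`: the common zeros of all forms that vanish on `V`. -/
def projClosure {N : ℕ} (V : Set (Fin N → ℂ)) : Set (PN N) :=
  {x | ∀ d, ∀ p ∈ forms N d, (∀ v ∈ V, evalAt (embed v) p = 0) → evalAt x p = 0}

/-- `X_∞ = X \ V`. -/
def pointsAtInfinity {N : ℕ} (V : Set (Fin N → ℂ)) : Set (PN N) :=
  projClosure V \ embed '' V

/-! ## Homogenization -/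

/-- The homogenization `z₀ ^ (deg F) * F (z₁ / z₀, …, z_N / z₀)` of `F`. -/
noncomputable def homogenization {N : ℕ} (F : MvPolynomial (Fin N) ℂ) : HomPoly N :=
  ∑ s ∈ F.support, monomial (Finsupp.cons (F.totalDegree - s.degree) s) (coeff s F)

theorem homogenization_mem {N : ℕ} (F : MvPolynomial (Fin N) ℂ) :
    homogenization F ∈ forms N F.totalDegree := by
  refine Submodule.sum_mem _ fun s hs => ?_
  rw [mem_homogeneousSubmodule]
  apply isHomogeneous_monomial
  have h : s.degree ≤ F.totalDegree := by
    have := le_totalDegree hs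
    rwa [Finsupp.sum_fintype _ _ (fun _ => rfl), ← Finsupp.degree_eq_sum] at this
  rw [Finsupp.degree_eq_sum, Fin.sum_univ_succ]
  simp only [Finsupp.cons_zero, Finsupp.cons_succ]
  rw [← Finsupp.degree_eq_sum]
  omega

/-- The homogeneous ideal `J_f ⊆ ℂ[z₀, …, z_N]` generated by the homogenizations of the `F_j`. -/
noncomputable def homogeneousIdeal {N m : ℕ} (F : Fin m → MvPolynomial (Fin N) ℂ) :
    Ideal (HomPoly N) :=
  Ideal.span (Set.range fun j => homogenization (F j))

/-! ## Local rings and the ideal sheaf `𝒥_f` -/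

/-- The polynomials that do not vanish at (the chosen representative of) `x`. -/
noncomputable def nonvanishing {N : ℕ} (x : PN N) : Submonoid (HomPoly N) where
  carrier := {q | evalAt x q ≠ 0}
  one_mem' := by simp [evalAt]
  mul_mem' := by
    intro a b ha hb
    simpa [evalAt] using And.intro ha hb

/-- The local ring `𝒪_{ℙᴺ, x}`: fractions `p / q` of forms of equal degree with `q x ≠ 0`. -/
abbrev LocalRingPN {N : ℕ} (x : PN N) : Type :=
  HomogeneousLocalization (forms N) (nonvanishing x)

/-- The germs at `x` of a form `p` of degree `d`, as a section of `𝒪(d)`, in the local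
trivializations of `𝒪(d)`: all `p / q` with `q` a form of degree `d` and `q x ≠ 0`. Any two of
them differ by a unit. -/
noncomputable def sectionGerms {N : ℕ} (x : PN N) (d : ℕ) (p : forms N d) : Set (LocalRingPN x) :=
  {s | ∃ (q : forms N d) (hq : (q : HomPoly N) ∈ nonvanishing x),
    s = HomogeneousLocalization.mk ⟨d, p, q, hq⟩}

/-- The stalk at `x` of the ideal sheaf of `X`: generated by the germs of all forms that
vanish on `X`. -/
noncomputable def idealOfX {N : ℕ} (V : Set (Fin N → ℂ)) (x : PN N) : Ideal (LocalRingPN x) :=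
  Ideal.span (⋃ (d : ℕ) (p : forms N d) (_ : ∀ y ∈ projClosure V, evalAt y (p : HomPoly N) = 0),
    sectionGerms x d p)

/-- The local ring `𝒪_{X, x}`. -/
abbrev LocalRingX {N : ℕ} (V : Set (Fin N → ℂ)) (x : PN N) : Type :=
  LocalRingPN x ⧸ idealOfX V x

/-- The germs at `x` of the restriction to `X` of a form `p`. -/
noncomputable def sectionGermsX {N : ℕ} (V : Set (Fin N → ℂ)) (x : PN N) (d : ℕ) (p : forms N d) :
    Set (LocalRingX V x) :=
  Ideal.Quotient.mk (idealOfX V x) '' sectionGerms x d p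

/-- The stalk `(𝒥_f)_x ⊆ 𝒪_{X, x}` of the ideal sheaf generated by the sections `f_j` of
`𝒪(deg F_j)|_X` induced by the `F_j`. -/
noncomputable def stalkJ {N m : ℕ} (V : Set (Fin N → ℂ)) (F : Fin m → MvPolynomial (Fin N) ℂ) (x : PN N) :
    Ideal (LocalRingX V x) :=
  Ideal.span (⋃ j, sectionGermsX V x (F j).totalDegree
    ⟨homogenization (F j), homogenization_mem (F j)⟩)

/-- The germs at `x` of the equation `z₀ = 0` of `X_∞` in `X`. -/
noncomputable def infinityGerms {N : ℕ} (V : Set (Fin N → ℂ)) (x : PN N) : Set (LocalRingX V x) :=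
  sectionGermsX V x 1 ⟨X 0, isHomogeneous_X ℂ 0⟩

/-- Some associated variety of `𝒥_f` is contained in `X_∞`: at some `x ∈ X_∞` there is an
associated prime of the ideal `(𝒥_f)_x` of `𝒪_{X, x}` whose variety is contained in `X_∞`. -/
def HasAssociatedVarietyAtInfinity {N m : ℕ} (V : Set (Fin N → ℂ))
    (F : Fin m → MvPolynomial (Fin N) ℂ) : Prop :=
  ∃ x ∈ pointsAtInfinity V,
    ∃ P ∈ associatedPrimes (LocalRingX V x) (LocalRingX V x ⧸ stalkJ V F x),
      PrimeSpectrum.zeroLocus (P : Set (LocalRingX V x)) ⊆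
        PrimeSpectrum.zeroLocus (infinityGerms V x)

/-! ## The division problem -/

/-- `F₁Q₁ + ⋯ + F_mQ_m = Φ` on `V`. -/
def IsRepresentation {N m : ℕ} (V : Set (Fin N → ℂ)) (F Q : Fin m → MvPolynomial (Fin N) ℂ)
    (Φ : MvPolynomial (Fin N) ℂ) : Prop :=
  ∀ v ∈ V, ∑ j, eval v (F j) * eval v (Q j) = eval v Φ

/-- `β` is an admissible constant: every `Φ` in the ideal `(F_j)` on `V` has a
representation on `V` with `deg (F_j Q_j) ≤ max (deg Φ) β` for all `j`. -/
def IsDegreeBound {N m : ℕ} (V : Set (Fin N → ℂ)) (F : Fin m → MvPolynomial (Fin N) ℂ)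
    (β : ℤ) : Prop :=
  ∀ Φ : MvPolynomial (Fin N) ℂ, (∃ Q, IsRepresentation V F Q Φ) →
    ∃ Q, IsRepresentation V F Q Φ ∧
      ∀ j, ((F j * Q j).totalDegree : ℤ) ≤ max (Φ.totalDegree : ℤ) β

/-! ## Regularity -/

/-- A minimal graded free resolution `⋯ → F₁ → F₀ → J → 0` of an ideal `J` of
`S = ℂ[z₀, …, z_N]`, where `F_k` is the direct sum of the modules `S (-shift k i)`, `i < rank k`.
The map `F₀ → J` is given by homogeneous generators of `J`, the maps `F_{k+1} → F_k` by matrices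
of forms of the appropriate degrees without nonzero constant entries. -/
structure MinimalGradedFreeResolution {N : ℕ} (J : Ideal (HomPoly N)) where
  /-- the rank of `F_k` -/
  rank : ℕ → ℕ
  /-- the degrees of the basis elements of `F_k` -/
  shift : (k : ℕ) → Fin (rank k) → ℕ
  /-- the images in `J` of the basis elements of `F₀` -/
  gen : Fin (rank 0) → HomPoly N
  /-- the matrix of `F_{k+1} → F_k` -/
  diff : (k : ℕ) → Matrix (Fin (rank k)) (Fin (rank (k + 1))) (HomPoly N)
  gen_homogeneous : ∀ i, (gen i).IsHomogeneous (shift 0 i)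
  diff_homogeneous : ∀ k i j, diff k i j ≠ 0 →
    ∃ e, shift k i + e = shift (k + 1) j ∧ (diff k i j).IsHomogeneous e
  span_gen : Ideal.span (Set.range gen) = J
  exact_gen : ∀ v : Fin (rank 0) → HomPoly N,
    ∑ i, v i * gen i = 0 ↔ ∃ w, v = (diff 0).mulVec w
  exact_diff : ∀ k, ∀ v : Fin (rank (k + 1)) → HomPoly N,
    (diff k).mulVec v = 0 ↔ ∃ w, v = (diff (k + 1)).mulVec w
  minimal : ∀ k i j, constantCoeff (diff k i j) = 0

/-- The (Castelnuovo–Mumford) regularity of a homogeneous ideal `J`: the maximum of `d - k` over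
the degrees `d` of the basis elements of the `k`-th module in a minimal graded free resolution
of `J`. (The degrees do not depend on the resolution; for `J = 0` there are none and the value
is `0`.) -/
noncomputable def regularity {N : ℕ} (J : Ideal (HomPoly N)) : ℤ :=
  sSup {r | ∃ (E : MinimalGradedFreeResolution J) (k : ℕ) (i : Fin (E.rank k)),
    r = (E.shift k i : ℤ) - k}

end DivisionProblem

/-! Let `I` be the sum of the homogeneous ideal of `X` and `J_f` (`divisionIdeal`). Homogenizing and
dehomogenizing, a polynomial Φ with `deg Φ ≤ D` has a representation with all `deg (F_j Q_j) ≤ D` if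
and only if its homogenization to degree `D` lies in `I`. It has some representation if and only if
a power of `z₀` times that form lies in `I`. So β is admissible exactly when `I` agrees with its
`z₀`-saturation in every degree `D ≥ β` (`isDegreeBound_of_isSaturatedInDegree`,
`IsDegreeBound.isSaturatedInDegree`).

The stalks of 𝒥_f are the degree-zero localizations of `I` (`germ_mem_stalkJ_iff`). An associated
variety at infinity means that an associated prime at a point of `X_∞` contains `z₀`. If there is
none, `I` and its saturation agree locally at every point of `ℙᴺ`; by the Nullstellensatz a power of
the irrelevant ideal carries each of finitely many generators of the saturation into `I`, so the two
agree in large degrees. If there is one, some form `g` has `z₀ g ∈ I` but is not in `I` locally at a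
point `x`; multiplying `g` by powers of a coordinate that is nonzero at `x` destroys saturation in
arbitrarily large degrees.

For `V = ℂᴺ` one has `I = J_f`, and saturation descends from large degrees to `reg J_f`. If `J_f` is
saturated in degree `D + 1` but a form `g` of degree `D` violates saturation, every `z_i g` lies in
`J_f`, so `g` is a socle element of `S / J_f`. It yields a nonzero class in `Tor_{N+1}(S / J_f, ℂ)`
of degree `D + N + 1`, hence a basis element of that degree in `F_N`, and `reg J_f ≥ D + 1`. As
`regularity` is a supremum over all minimal resolutions, its use also requires that one exists, that
the shifts do not depend on it, and that its length is at most `N`. -/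

namespace DivisionProblem

/-! ## Homogeneous components -/

section HomogeneousComponents

variable {σ R : Type*} [CommRing R]

theorem coe_decompose_eq_homogeneousComponent (n : ℕ) (p : MvPolynomial σ R) :
    (DirectSum.decompose (homogeneousSubmodule σ R) p n : MvPolynomial σ R) =
      homogeneousComponent n p :=
  decomposition.decompose'_apply p n

theorem homogeneousComponent_mul_of_le {p q : MvPolynomial σ R} {e n : ℕ} (hp : p.IsHomogeneous e)
    (h : e ≤ n) : homogeneousComponent n (p * q) = p * homogeneousComponent (n - e) q := by
  simp only [← coe_decompose_eq_homogeneousComponent]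
  exact DirectSum.coe_decompose_mul_of_left_mem_of_le _ hp h

theorem homogeneousComponent_mul_of_lt {p q : MvPolynomial σ R} {e n : ℕ} (hp : p.IsHomogeneous e)
    (h : n < e) : homogeneousComponent n (p * q) = 0 := by
  simp only [← coe_decompose_eq_homogeneousComponent]
  exact DirectSum.coe_decompose_mul_of_left_mem_of_not_le _ hp (by omega)

theorem IsHomogeneous.component_eq {p : MvPolynomial σ R} {n : ℕ} (hp : p.IsHomogeneous n) :
    homogeneousComponent n p = p :=
  homogeneousComponent_eq_self hp

theorem IsHomogeneous.eval_smul [Finite σ] {p : MvPolynomial σ R} {n : ℕ} (hp : p.IsHomogeneous n)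
    (c : R) (v : σ → R) : eval (c • v) p = c ^ n * eval v p := by
  classical
  cases nonempty_fintype σ
  rw [eval_eq', eval_eq', Finset.mul_sum]
  refine Finset.sum_congr rfl fun s hs => ?_
  have h := hp.degree_eq_sum_deg_support hs
  simp only [Pi.smul_apply, smul_eq_mul, mul_pow, Finset.prod_mul_distrib, Finset.prod_pow_eq_pow_sum]
  rw [show ∑ i, s i = n from by rw [h, ← Finsupp.degree_eq_sum]; rfl]
  ring

end HomogeneousComponents

/-! ## Homogenization and dehomogenization -/

variable {N m : ℕ}

/-- The dehomogenization `p ↦ p (1, x₁, …, x_N)`. -/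
noncomputable def dehomogenize : HomPoly N →ₐ[ℂ] MvPolynomial (Fin N) ℂ :=
  aeval (Fin.cons 1 X)

theorem eval_dehomogenize (v : Fin N → ℂ) (p : HomPoly N) :
    eval v (dehomogenize p) = eval (Fin.cons 1 v : Fin (N + 1) → ℂ) p := by
  have : (eval v).comp (dehomogenize (N := N)).toRingHom =
      eval (Fin.cons 1 v : Fin (N + 1) → ℂ) := by
    apply ringHom_ext
    · intro r; simp [dehomogenize]
    · intro i
      refine Fin.cases ?_ (fun j => ?_) i <;> simp [dehomogenize]
  exact DFunLike.congr_fun this p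

/-- The homogenization of `F` to degree `D`; meaningful for `deg F ≤ D`. -/
noncomputable def homogenizeTo (D : ℕ) (F : MvPolynomial (Fin N) ℂ) : HomPoly N :=
  ∑ s ∈ F.support, monomial (Finsupp.cons (D - s.degree) s) (coeff s F)

theorem degree_finsuppCons (k : ℕ) (s : Fin N →₀ ℕ) :
    (Finsupp.cons k s).degree = k + s.degree := by
  rw [Finsupp.degree_eq_sum, Fin.sum_univ_succ]
  simp only [Finsupp.cons_zero, Finsupp.cons_succ]
  rw [← Finsupp.degree_eq_sum]

theorem degree_le_totalDegree {F : MvPolynomial (Fin N) ℂ} {s : Fin N →₀ ℕ} (hs : s ∈ F.support) :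
    s.degree ≤ F.totalDegree := by
  have := le_totalDegree hs
  rwa [Finsupp.sum_fintype _ _ (fun _ => rfl), ← Finsupp.degree_eq_sum] at this

theorem homogenizeTo_isHomogeneous {D : ℕ} {F : MvPolynomial (Fin N) ℂ} (h : F.totalDegree ≤ D) :
    (homogenizeTo D F).IsHomogeneous D := by
  refine (mem_homogeneousSubmodule _ _).1 (Submodule.sum_mem _ fun s hs => ?_)
  apply isHomogeneous_monomial
  have := degree_le_totalDegree hs
  rw [degree_finsuppCons]
  omega

theorem homogenization_isHomogeneous (F : MvPolynomial (Fin N) ℂ) :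
    (homogenization F).IsHomogeneous F.totalDegree :=
  homogenization_mem F

theorem dehomogenize_homogenizeTo (D : ℕ) (F : MvPolynomial (Fin N) ℂ) :
    dehomogenize (homogenizeTo D F) = F := by
  conv_rhs => rw [F.as_sum]
  rw [homogenizeTo, map_sum]
  refine Finset.sum_congr rfl fun s _ => ?_
  rw [dehomogenize, aeval_monomial, Finsupp.prod_fintype _ _ (by simp), Fin.prod_univ_succ,
    monomial_eq, Finsupp.prod_fintype _ _ (by simp)]
  simp

theorem eval_homogenizeTo (D : ℕ) (F : MvPolynomial (Fin N) ℂ) (v : Fin N → ℂ) :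
    eval (Fin.cons 1 v : Fin (N + 1) → ℂ) (homogenizeTo D F) = eval v F := by
  rw [← eval_dehomogenize, dehomogenize_homogenizeTo]

theorem eval_homogenization (F : MvPolynomial (Fin N) ℂ) (v : Fin N → ℂ) :
    eval (Fin.cons 1 v : Fin (N + 1) → ℂ) (homogenization F) = eval v F :=
  eval_homogenizeTo _ F v

theorem totalDegree_dehomogenize_le {p : HomPoly N} {d : ℕ} (hp : p.IsHomogeneous d) :
    (dehomogenize p).totalDegree ≤ d := by
  conv_lhs => rw [p.as_sum, map_sum]
  refine totalDegree_finsetSum_le fun s hs => ?_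
  rw [dehomogenize, aeval_monomial, Finsupp.prod_fintype _ _ (by simp), Fin.prod_univ_succ]
  simp only [Fin.cons_zero, Fin.cons_succ, one_pow, one_mul, algebraMap_eq]
  have h1 := hp.degree_eq_sum_deg_support hs
  have h2 : (∏ i : Fin N, (X i : MvPolynomial (Fin N) ℂ) ^ s i.succ).totalDegree ≤ d := by
    refine (totalDegree_finsetProd _ _).trans ?_
    simp only [totalDegree_X_pow]
    rw [h1]
    change _ ≤ s.degree
    rw [Finsupp.degree_eq_sum, Fin.sum_univ_succ]
    omega
  refine (totalDegree_mul _ _).trans ?_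
  rw [totalDegree_C]
  omega

/-! ## The homogeneous ideal of `X` and of the sections `f_j` on `X` -/

/-- The forms that vanish on `V`. -/
def vanishingForms (V : Set (Fin N → ℂ)) : Set (HomPoly N) :=
  {p | ∃ d, p.IsHomogeneous d ∧ ∀ v ∈ V, eval (Fin.cons 1 v : Fin (N + 1) → ℂ) p = 0}

/-- The homogeneous ideal of `X`. -/
noncomputable def vanishingIdealX (V : Set (Fin N → ℂ)) : Ideal (HomPoly N) :=
  Ideal.span (vanishingForms V)

/-- The homogeneous ideal in `ℂ[z₀, …, z_N]` that defines the ideal sheaf `𝒥_f` on `X`. -/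
noncomputable def divisionIdeal (V : Set (Fin N → ℂ)) (F : Fin m → MvPolynomial (Fin N) ℂ) :
    Ideal (HomPoly N) :=
  vanishingIdealX V ⊔ homogeneousIdeal F

theorem vanishingIdealX_isHomogeneous (V : Set (Fin N → ℂ)) :
    (vanishingIdealX V).IsHomogeneous (forms N) :=
  Ideal.homogeneous_span _ _ fun _ ⟨d, hd, _⟩ => ⟨d, hd⟩

theorem homogeneousIdeal_isHomogeneous (F : Fin m → MvPolynomial (Fin N) ℂ) :
    (homogeneousIdeal F).IsHomogeneous (forms N) := by
  apply Ideal.homogeneous_span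
  rintro _ ⟨j, rfl⟩
  exact ⟨_, homogenization_mem (F j)⟩

theorem eval_eq_zero_of_mem_vanishingIdealX {V : Set (Fin N → ℂ)} {p : HomPoly N}
    (hp : p ∈ vanishingIdealX V) {v : Fin N → ℂ} (hv : v ∈ V) :
    eval (Fin.cons 1 v : Fin (N + 1) → ℂ) p = 0 := by
  have : vanishingIdealX V ≤ RingHom.ker (eval (Fin.cons 1 v : Fin (N + 1) → ℂ)) :=
    Ideal.span_le.2 fun q ⟨_, _, hq⟩ => hq v hv
  exact this hp

/-! ### Degree bounds and saturation with respect to `z₀` -/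

/-- The saturation of `J` with respect to `z₀` agrees with `J` in degree `D`. -/
def IsSaturatedInDegree (J : Ideal (HomPoly N)) (D : ℕ) : Prop :=
  ∀ g : HomPoly N, g.IsHomogeneous D → ∀ k, X 0 ^ k * g ∈ J → g ∈ J

/-- A form of degree `D` belongs to `divisionIdeal V F` as soon as its dehomogenization has a
representation with terms of degree at most `D`. -/
theorem mem_divisionIdeal_of_isRepresentation {V : Set (Fin N → ℂ)}
    {F Q : Fin m → MvPolynomial (Fin N) ℂ} {D : ℕ} {g : HomPoly N} (hg : g.IsHomogeneous D)
    (hQ : IsRepresentation V F Q (dehomogenize g)) (hD : ∀ j, (F j * Q j).totalDegree ≤ D) :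
    g ∈ divisionIdeal V F := by
  classical
  -- If `F_j Q_j = 0`, the degree hypothesis bounds neither `deg F_j` nor `deg Q_j`; the term
  -- contributes nothing and is replaced by zero.
  let q : Fin m → HomPoly N := fun j =>
    if F j * Q j = 0 then 0 else homogenizeTo (D - (F j).totalDegree) (Q j)
  have hq : ∀ j, (homogenization (F j) * q j).IsHomogeneous D := by
    intro j
    by_cases h0 : F j * Q j = 0
    · simp only [q, if_pos h0, mul_zero, isHomogeneous_zero]
    · have h1 := hD j
      rw [totalDegree_mul_of_isDomain (left_ne_zero_of_mul h0) (right_ne_zero_of_mul h0)] at h1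
      simp only [q, if_neg h0]
      have := (homogenization_isHomogeneous (F j)).mul
        (homogenizeTo_isHomogeneous (D := D - (F j).totalDegree) (F := Q j) (by omega))
      rwa [Nat.add_sub_cancel' (by omega)] at this
  have hmem : ∑ j, homogenization (F j) * q j ∈ homogeneousIdeal F :=
    Ideal.sum_mem _ fun j _ => Ideal.mul_mem_right _ _ (Ideal.subset_span ⟨j, rfl⟩)
  have hvan : g - ∑ j, homogenization (F j) * q j ∈ vanishingIdealX V := by
    refine Ideal.subset_span ⟨D, hg.sub (IsHomogeneous.sum _ _ _ fun j _ => hq j), fun v hv => ?_⟩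
    rw [map_sub, ← eval_dehomogenize, ← hQ v hv, map_sum, sub_eq_zero]
    refine Finset.sum_congr rfl fun j _ => ?_
    rw [map_mul, eval_homogenization]
    by_cases h0 : F j * Q j = 0
    · simp only [q, if_pos h0, ← map_mul, h0, map_zero, mul_zero]
    · simp only [q, if_neg h0, eval_homogenizeTo]
  rw [← sub_add_cancel g (∑ j, homogenization (F j) * q j)]
  exact add_mem (Ideal.mem_sup_left hvan) (Ideal.mem_sup_right hmem)

/-- The forms of degree `D` in `divisionIdeal V F` give representations with terms of degree
at most `D`. -/
theorem exists_isRepresentation_of_mem_divisionIdeal {V : Set (Fin N → ℂ)}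
    {F : Fin m → MvPolynomial (Fin N) ℂ} {D : ℕ} {g : HomPoly N} (hg : g.IsHomogeneous D)
    (hJ : g ∈ divisionIdeal V F) :
    ∃ Q, IsRepresentation V F Q (dehomogenize g) ∧ ∀ j, (F j * Q j).totalDegree ≤ D := by
  classical
  obtain ⟨i, hi, f, hf, rfl⟩ := Submodule.mem_sup.1 hJ
  obtain ⟨a, rfl⟩ := Ideal.mem_span_range_iff_exists_fun.1 hf
  -- Only the degree-`D` part of each `a_j f̂_j` matters, and it vanishes when `deg F_j > D`.
  let q : Fin m → HomPoly N := fun j =>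
    if (F j).totalDegree ≤ D then homogeneousComponent (D - (F j).totalDegree) (a j) else 0
  have hq : ∀ j, homogeneousComponent D (a j * homogenization (F j)) =
      homogenization (F j) * q j := by
    intro j
    rw [mul_comm]
    by_cases h : (F j).totalDegree ≤ D
    · simp only [q, h, if_true]
      exact homogeneousComponent_mul_of_le (homogenization_isHomogeneous _) h
    · simp only [q, h, if_false, mul_zero]
      exact homogeneousComponent_mul_of_lt (homogenization_isHomogeneous _) (by omega)
  refine ⟨fun j => dehomogenize (q j), fun v hv => ?_, fun j => ?_⟩
  · rw [eval_dehomogenize, ← IsHomogeneous.component_eq hg, map_add, map_sum, map_add,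
      eval_eq_zero_of_mem_vanishingIdealX
        (homogeneousComponent_mem_of_mem (vanishingIdealX_isHomogeneous V) hi D) hv,
      zero_add, map_sum]
    refine Finset.sum_congr rfl fun j _ => ?_
    rw [hq, map_mul, eval_homogenization, eval_dehomogenize]
  · by_cases h : (F j).totalDegree ≤ D
    · refine (totalDegree_mul _ _).trans ?_
      simp only [q, h, if_true]
      have := totalDegree_dehomogenize_le
        (homogeneousComponent_isHomogeneous (D - (F j).totalDegree) (a j))
      omega
    · simp [q, h]

/-- A bound `β` is admissible if `divisionIdeal V F` is saturated with respect to `z₀` in all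
degrees `D ≥ β`. -/
theorem isDegreeBound_of_isSaturatedInDegree {V : Set (Fin N → ℂ)}
    {F : Fin m → MvPolynomial (Fin N) ℂ} {β : ℤ}
    (h : ∀ D : ℕ, β ≤ D → IsSaturatedInDegree (divisionIdeal V F) D) : IsDegreeBound V F β := by
  rintro Φ ⟨Q, hQ⟩
  obtain ⟨D, hD⟩ : ∃ D : ℕ, (D : ℤ) = max (Φ.totalDegree : ℤ) β :=
    Int.eq_ofNat_of_zero_le (le_max_of_le_left (by positivity)) |>.imp fun _ h => h.symm
  have hΦ : Φ.totalDegree ≤ D := by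
    have := le_max_left (Φ.totalDegree : ℤ) β
    omega
  have hβ : β ≤ D := hD ▸ le_max_right _ _
  have hg := homogenizeTo_isHomogeneous hΦ
  -- The sum is a crude common bound for all `deg (F_j Q_j)`, so multiplication by `z₀ ^ E` leaves
  -- room for the given, uncontrolled representation.
  set E := ∑ j, (F j * Q j).totalDegree
  have key : homogenizeTo D Φ ∈ divisionIdeal V F := by
    refine h D hβ _ hg E (mem_divisionIdeal_of_isRepresentation (Q := Q) (D := E + D) ?_ ?_ ?_)
    · simpa using ((isHomogeneous_X ℂ 0).pow E).mul hg
    · intro v hv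
      rw [hQ v hv, eval_dehomogenize, map_mul, eval_homogenizeTo]
      simp
    · intro j
      have := Finset.single_le_sum (f := fun j => (F j * Q j).totalDegree)
        (fun _ _ => Nat.zero_le _) (Finset.mem_univ j)
      exact this.trans (Nat.le_add_right _ _)
  obtain ⟨Q', hQ', hdeg⟩ := exists_isRepresentation_of_mem_divisionIdeal hg key
  rw [dehomogenize_homogenizeTo] at hQ'
  exact ⟨Q', hQ', fun j => hD ▸ by exact_mod_cast hdeg j⟩

/-- If `β` is admissible, `divisionIdeal V F` is saturated with respect to `z₀` in all
degrees `D ≥ β`. -/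
theorem IsDegreeBound.isSaturatedInDegree {V : Set (Fin N → ℂ)}
    {F : Fin m → MvPolynomial (Fin N) ℂ} {β : ℤ} (h : IsDegreeBound V F β) {D : ℕ} (hD : β ≤ D) :
    IsSaturatedInDegree (divisionIdeal V F) D := by
  intro g hg k hk
  have hXg : (X 0 ^ k * g).IsHomogeneous (k + D) := by
    simpa using ((isHomogeneous_X ℂ (0 : Fin (N + 1))).pow k).mul hg
  have hX : dehomogenize (X 0 ^ k * g) = dehomogenize g := by
    simp [dehomogenize]
  obtain ⟨Q, hQ, -⟩ := exists_isRepresentation_of_mem_divisionIdeal hXg hk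
  rw [hX] at hQ
  obtain ⟨Q', hQ', hdeg⟩ := h _ ⟨Q, hQ⟩
  refine mem_divisionIdeal_of_isRepresentation hg hQ' fun j => ?_
  have h1 := hdeg j
  have h2 := totalDegree_dehomogenize_le hg
  have h3 : max ((dehomogenize g).totalDegree : ℤ) β ≤ D := max_le (by exact_mod_cast h2) hD
  exact_mod_cast h1.trans h3

/-- A form `p` that vanishes wherever `z₀ = 1` vanishes by homogeneity wherever `z₀ ≠ 0`. Then `z₀
p` vanishes everywhere, so `p = 0`. -/
theorem divisionIdeal_univ (F : Fin m → MvPolynomial (Fin N) ℂ) :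
    divisionIdeal Set.univ F = homogeneousIdeal F := by
  refine sup_eq_right.2 (Ideal.span_le.2 ?_)
  rintro p ⟨d, hd, hp⟩
  have h0 : X 0 * p = 0 := by
    refine MvPolynomial.funext fun v => ?_
    rw [map_mul, eval_X, map_zero]
    by_cases hv : v 0 = 0
    · rw [hv, zero_mul]
    · have : v = v 0 • (Fin.cons 1 fun i => v i.succ / v 0 : Fin (N + 1) → ℂ) := by
        funext i
        refine Fin.cases ?_ (fun j => ?_) i
        · simp
        · simp [mul_div_cancel₀ _ hv]
      rw [this, IsHomogeneous.eval_smul hd, hp _ (Set.mem_univ _), mul_zero, mul_zero]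
  rw [(mul_eq_zero.1 h0).resolve_left (X_ne_zero 0)]
  exact Ideal.zero_mem _

/-! ## Germs -/

/-- The germ `p / q` at `x`, for forms `p`, `q` of equal degree with `q x ≠ 0`. -/
noncomputable def germ {x : PN N} {d : ℕ} {p q : HomPoly N} (hp : p.IsHomogeneous d)
    (hq : q.IsHomogeneous d) (hx : q ∈ nonvanishing x) : LocalRingPN x :=
  HomogeneousLocalization.mk ⟨d, ⟨p, hp⟩, ⟨q, hq⟩, hx⟩

theorem exists_eq_germ {x : PN N} (a : LocalRingPN x) :
    ∃ (d : ℕ) (p q : HomPoly N) (hp : p.IsHomogeneous d) (hq : q.IsHomogeneous d)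
      (hx : q ∈ nonvanishing x), a = germ hp hq hx := by
  obtain ⟨⟨d, p, q, hx⟩, rfl⟩ := HomogeneousLocalization.mk_surjective a
  exact ⟨d, p, q, p.2, q.2, hx, rfl⟩

theorem nonvanishing_le_nonZeroDivisors (x : PN N) :
    nonvanishing x ≤ nonZeroDivisors (HomPoly N) := by
  intro q hq
  refine mem_nonZeroDivisors_of_ne_zero ?_
  rintro rfl
  exact hq (by simp [evalAt])

section

variable {x : PN N} {d e : ℕ} {p q p' q' : HomPoly N}

/-- The polynomial ring is a domain, so no auxiliary factor is needed in the equality of fractions.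
-/
theorem germ_eq_germ_iff (hp : p.IsHomogeneous d) (hq : q.IsHomogeneous d)
    (hx : q ∈ nonvanishing x) (hp' : p'.IsHomogeneous e) (hq' : q'.IsHomogeneous e)
    (hx' : q' ∈ nonvanishing x) : germ hp hq hx = germ hp' hq' hx' ↔ p * q' = p' * q := by
  rw [HomogeneousLocalization.ext_iff_val, germ, germ, HomogeneousLocalization.val_mk,
    HomogeneousLocalization.val_mk, Localization.mk_eq_mk_iff, Localization.r_iff_exists]
  constructor
  · rintro ⟨c, hc⟩
    have := (mem_nonZeroDivisors_iff.1 (nonvanishing_le_nonZeroDivisors x c.2)).1 _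
      (show (c : HomPoly N) * (q' * p - q * p') = 0 by rw [mul_sub, sub_eq_zero]; exact hc)
    linear_combination this
  · intro h
    exact ⟨1, by simp only [OneMemClass.coe_one]; linear_combination h⟩

theorem germ_mul_germ (hp : p.IsHomogeneous d) (hq : q.IsHomogeneous d)
    (hx : q ∈ nonvanishing x) (hp' : p'.IsHomogeneous e) (hq' : q'.IsHomogeneous e)
    (hx' : q' ∈ nonvanishing x) : germ hp hq hx * germ hp' hq' hx' =
      germ (hp.mul hp') (hq.mul hq') (mul_mem hx hx') := rfl

theorem germ_add_germ (hp : p.IsHomogeneous d) (hq : q.IsHomogeneous d)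
    (hx : q ∈ nonvanishing x) (hp' : p'.IsHomogeneous e) (hq' : q'.IsHomogeneous e)
    (hx' : q' ∈ nonvanishing x) : germ hp hq hx + germ hp' hq' hx' =
      germ ((hq.mul hp').add (add_comm e d ▸ hq'.mul hp)) (hq.mul hq') (mul_mem hx hx') := rfl

theorem germ_zero (hq : q.IsHomogeneous d) (hx : q ∈ nonvanishing x) :
    germ (isHomogeneous_zero _ _ d) hq hx = 0 :=
  HomogeneousLocalization.mk_eq_zero_of_num _ rfl

theorem germ_congr (h : p = p') (hp : p.IsHomogeneous d) (hp' : p'.IsHomogeneous d)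
    (hq : q.IsHomogeneous d) (hx : q ∈ nonvanishing x) : germ hp hq hx = germ hp' hq hx := by
  subst h; rfl

theorem germ_pow (hp : p.IsHomogeneous d) (hq : q.IsHomogeneous d)
    (hx : q ∈ nonvanishing x) (k : ℕ) :
    germ hp hq hx ^ k = germ (hp.pow k) (hq.pow k) (pow_mem hx k) := by
  rw [germ, ← HomogeneousLocalization.mk_pow]
  exact (germ_eq_germ_iff (p := p ^ k) (q := q ^ k) (by simpa [mul_comm] using hp.pow k)
    (by simpa [mul_comm] using hq.pow k) (pow_mem hx k) _ _ _).2 rfl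

end

theorem exists_X_mem_nonvanishing (x : PN N) : ∃ i, (X i : HomPoly N) ∈ nonvanishing x := by
  obtain ⟨i, hi⟩ := Function.ne_iff.1 x.rep_nonzero
  exact ⟨i, by simpa [nonvanishing, evalAt] using hi⟩

/-- An ideal of the local ring that contains a germ of each form in `G` contains the germs of all
forms in the homogeneous ideal generated by `G`. -/
theorem germ_mem_of_mem_span {x : PN N} {I : Ideal (LocalRingPN x)} {G : Set (HomPoly N)}
    (hG : ∀ g ∈ G, ∃ (d : ℕ) (q : HomPoly N) (hg : g.IsHomogeneous d) (hq : q.IsHomogeneous d)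
      (hx : q ∈ nonvanishing x), germ hg hq hx ∈ I)
    {d : ℕ} {p q : HomPoly N} (hp : p.IsHomogeneous d) (hq : q.IsHomogeneous d)
    (hx : q ∈ nonvanishing x) (hpG : p ∈ Ideal.span G) : germ hp hq hx ∈ I := by
  -- The summands of an element of the span need not be homogeneous; the statement is proved for
  -- their components of degree `d`, which is additive.
  let T : HomPoly N → Prop := fun p =>
    germ (homogeneousComponent_isHomogeneous d p) hq hx ∈ I
  suffices T p by
    simpa only [T, germ_congr (IsHomogeneous.component_eq hp) _ hp] using this
  obtain ⟨n, f, g, rfl⟩ := Submodule.mem_span_set'.1 hpG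
  refine Finset.sum_induction _ T (fun a b ha hb => ?_) ?_ fun i _ => ?_
  · convert add_mem ha hb using 1
    rw [germ_add_germ, germ_eq_germ_iff, map_add]
    ring
  · convert I.zero_mem
    rw [germ_congr (map_zero _) _ (isHomogeneous_zero _ _ d), germ_zero]
  · obtain ⟨e, r, hg, hr, hxr, hI⟩ := hG _ (g i).2
    simp only [T, smul_eq_mul]
    rw [mul_comm]
    by_cases he : e ≤ d
    · rw [germ_congr (homogeneousComponent_mul_of_le hg he) _
        (homogeneousComponent_mul_of_le hg he ▸ homogeneousComponent_isHomogeneous _ _)]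
      have hc := (homogeneousComponent_isHomogeneous (d - e) (f i)).mul hr
      rw [Nat.sub_add_cancel he] at hc
      convert I.mul_mem_left (germ hc hq hx) hI using 1
      rw [germ_mul_germ, germ_eq_germ_iff]
      ring
    · rw [germ_congr (homogeneousComponent_mul_of_lt hg (not_le.1 he)) _
        (isHomogeneous_zero _ _ d), germ_zero]
      exact I.zero_mem

/-- Sending `I` to the polynomial ideal generated by the numerators of its germs is strictly
monotone, since `germ_mem_of_mem_span` recovers `I`. The ascending chain condition is thus inherited
from the polynomial ring. -/
instance isNoetherianRing_localRingPN (x : PN N) : IsNoetherianRing (LocalRingPN x) := by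
  let G : Ideal (LocalRingPN x) → Set (HomPoly N) := fun I =>
    {p | ∃ (d : ℕ) (q : HomPoly N) (hg : p.IsHomogeneous d) (hq : q.IsHomogeneous d)
      (hx : q ∈ nonvanishing x), germ hg hq hx ∈ I}
  have hle : ∀ I I', Ideal.span (G I) ≤ Ideal.span (G I') → I ≤ I' := by
    intro I I' h a ha
    obtain ⟨d, p, q, hp, hq, hx, rfl⟩ := exists_eq_germ a
    exact germ_mem_of_mem_span (G := G I') (fun g hg => hg) hp hq hx
      (h (Ideal.subset_span ⟨d, q, hp, hq, hx, ha⟩))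
  have hmono : StrictMono fun I => Ideal.span (G I) := by
    intro I I' h
    refine lt_of_le_not_ge (Ideal.span_mono ?_) fun h' => h.not_ge (hle _ _ h')
    rintro p ⟨d, q, hp, hq, hx, hI⟩
    exact ⟨d, q, hp, hq, hx, h.le hI⟩
  exact isNoetherian_iff'.2 hmono.wellFoundedGT

/-! ## Forms on `V` and on `X` -/

theorem evalAt_embed_eq_zero_iff {p : HomPoly N} {d : ℕ} (hp : p.IsHomogeneous d)
    (v : Fin N → ℂ) :
    evalAt (embed v) p = 0 ↔ eval (Fin.cons 1 v : Fin (N + 1) → ℂ) p = 0 := by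
  obtain ⟨c, hc⟩ := Projectivization.exists_smul_eq_mk_rep ℂ (Fin.cons 1 v : Fin (N + 1) → ℂ)
    (fun h => one_ne_zero (congrFun h 0))
  rw [evalAt, embed, ← hc, Units.smul_def, IsHomogeneous.eval_smul hp]
  simp

theorem forall_projClosure_iff {V : Set (Fin N → ℂ)} {p : HomPoly N} {d : ℕ}
    (hp : p.IsHomogeneous d) : (∀ y ∈ projClosure V, evalAt y p = 0) ↔ p ∈ vanishingForms V := by
  constructor
  · intro h
    refine ⟨d, hp, fun v hv => (evalAt_embed_eq_zero_iff hp v).1 (h _ ?_)⟩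
    exact fun e q _ hq => hq v hv
  · rintro ⟨-, -, h⟩ y hy
    exact hy d p hp fun v hv => (evalAt_embed_eq_zero_iff hp v).2 (h v hv)

/-! ## The stalks of `𝒥_f` -/

theorem divisionIdeal_eq_span (V : Set (Fin N → ℂ)) (F : Fin m → MvPolynomial (Fin N) ℂ) :
    divisionIdeal V F =
      Ideal.span (vanishingForms V ∪ Set.range fun j => homogenization (F j)) :=
  (Ideal.span_union _ _).symm

theorem comap_stalkJ (V : Set (Fin N → ℂ)) (F : Fin m → MvPolynomial (Fin N) ℂ) (x : PN N) :
    (stalkJ V F x).comap (Ideal.Quotient.mk (idealOfX V x)) =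
      idealOfX V x ⊔ Ideal.span (⋃ j, sectionGerms x (F j).totalDegree
        ⟨homogenization (F j), homogenization_mem (F j)⟩) := by
  have : stalkJ V F x = (Ideal.span (⋃ j, sectionGerms x (F j).totalDegree
      ⟨homogenization (F j), homogenization_mem (F j)⟩)).map
        (Ideal.Quotient.mk (idealOfX V x)) := by
    rw [Ideal.map_span, Set.image_iUnion]
    rfl
  rw [this, Ideal.comap_map_of_surjective' _ Ideal.Quotient.mk_surjective, Ideal.mk_ker, sup_comm]

/-- This is the dictionary between the sheaf and the homogeneous ideal: all later arguments about
stalks become statements about forms. -/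
theorem germ_mem_stalkJ_iff {V : Set (Fin N → ℂ)} {F : Fin m → MvPolynomial (Fin N) ℂ} {x : PN N}
    {d : ℕ} {p q : HomPoly N} (hp : p.IsHomogeneous d) (hq : q.IsHomogeneous d)
    (hx : q ∈ nonvanishing x) :
    Ideal.Quotient.mk (idealOfX V x) (germ hp hq hx) ∈ stalkJ V F x ↔
      ∃ (e : ℕ) (c : HomPoly N), c.IsHomogeneous e ∧ c ∈ nonvanishing x ∧
        c * p ∈ divisionIdeal V F := by
  rw [← Ideal.mem_comap, comap_stalkJ]
  constructor
  -- The germs that can be written with a numerator in `divisionIdeal V F` form an ideal, which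
  -- contains the generators of the stalk.
  · let T : Ideal (LocalRingPN x) :=
      { carrier := {a | ∃ (d : ℕ) (p q : HomPoly N) (hp : p.IsHomogeneous d)
          (hq : q.IsHomogeneous d) (hx : q ∈ nonvanishing x),
          a = germ hp hq hx ∧ p ∈ divisionIdeal V F}
        zero_mem' := ⟨0, 0, 1, isHomogeneous_zero _ _ _, isHomogeneous_one _ _, one_mem _,
          (germ_zero _ _).symm, zero_mem _⟩
        add_mem' := by
          rintro _ _ ⟨d, p, q, hp, hq, hx, rfl, hJ⟩ ⟨d', p', q', hp', hq', hx', rfl, hJ'⟩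
          exact ⟨_, _, _, _, _, _, germ_add_germ .., add_mem (Ideal.mul_mem_left _ _ hJ')
            (Ideal.mul_mem_left _ _ hJ)⟩
        smul_mem' := by
          rintro a _ ⟨d, p, q, hp, hq, hx, rfl, hJ⟩
          obtain ⟨d', p', q', hp', hq', hx', rfl⟩ := exists_eq_germ a
          exact ⟨_, _, _, _, _, _, germ_mul_germ .., Ideal.mul_mem_left _ _ hJ⟩ }
    have hT : idealOfX V x ⊔ Ideal.span (⋃ j, sectionGerms x (F j).totalDegree
        ⟨homogenization (F j), homogenization_mem (F j)⟩) ≤ T := by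
      refine sup_le (Ideal.span_le.2 ?_) (Ideal.span_le.2 ?_)
      · simp only [Set.iUnion_subset_iff]
        rintro d p hpX _ ⟨q, hq, rfl⟩
        exact ⟨d, p, q, p.2, q.2, hq, rfl,
          Ideal.mem_sup_left (Ideal.subset_span ((forall_projClosure_iff p.2).1 hpX))⟩
      · simp only [Set.iUnion_subset_iff]
        rintro j _ ⟨q, hq, rfl⟩
        exact ⟨_, _, q, homogenization_mem (F j), q.2, hq, rfl,
          Ideal.mem_sup_right (Ideal.subset_span ⟨j, rfl⟩)⟩
    intro h
    obtain ⟨e, p', q', hp', hq', hx', heq, hJ⟩ := hT h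
    rw [germ_eq_germ_iff] at heq
    refine ⟨e, q', hq', hx', ?_⟩
    rw [mul_comm, heq]
    exact Ideal.mul_mem_right _ _ hJ
  · rintro ⟨e, c, hc, hcx, hJ⟩
    rw [show germ hp hq hx = germ (hc.mul hp) (hc.mul hq) (mul_mem hcx hx) from
      (germ_eq_germ_iff ..).2 (by ring)]
    rw [divisionIdeal_eq_span] at hJ
    obtain ⟨i, hi⟩ := exists_X_mem_nonvanishing x
    refine germ_mem_of_mem_span ?_ _ _ _ hJ
    have hXi : ∀ d, (X i ^ d : HomPoly N).IsHomogeneous d := fun d => isHomogeneous_X_pow i d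
    rintro g (hg | ⟨j, rfl⟩)
    · obtain ⟨d, hd, -⟩ := id hg
      refine ⟨d, X i ^ d, hd, hXi d, pow_mem hi d, Ideal.mem_sup_left (Ideal.subset_span ?_)⟩
      simp only [Set.mem_iUnion]
      exact ⟨d, ⟨g, hd⟩, (forall_projClosure_iff hd).2 hg, ⟨_, hXi d⟩, pow_mem hi d, rfl⟩
    · refine ⟨_, X i ^ _, homogenization_isHomogeneous (F j), hXi _, pow_mem hi _,
        Ideal.mem_sup_right (Ideal.subset_span ?_)⟩
      simp only [Set.mem_iUnion]
      exact ⟨j, ⟨_, hXi _⟩, pow_mem hi _, rfl⟩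

/-- The associated prime `P` is the annihilator of the class of a germ `p / q`. Since `P` contains a
germ of `z₀`, some form `c` that is nonzero at `x` satisfies `c z₀ p ∈ I`, and `g = c p` is taken.
If `g` were in `I` locally at `x`, then `1` would be in `P`. -/
theorem HasAssociatedVarietyAtInfinity.exists_form {V : Set (Fin N → ℂ)}
    {F : Fin m → MvPolynomial (Fin N) ℂ} (h : HasAssociatedVarietyAtInfinity V F) :
    ∃ (x : PN N) (e : ℕ) (g : HomPoly N), g.IsHomogeneous e ∧ X 0 * g ∈ divisionIdeal V F ∧
      ∀ (d : ℕ) (c : HomPoly N), c.IsHomogeneous d → c ∈ nonvanishing x →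
        c * g ∉ divisionIdeal V F := by
  obtain ⟨x, -, P, hP, hPz⟩ := h
  obtain ⟨hprime, u, hu⟩ := isAssociatedPrime_iff.1 hP
  obtain ⟨a, rfl⟩ := Ideal.Quotient.mk_surjective u
  obtain ⟨a, rfl⟩ := Ideal.Quotient.mk_surjective a
  obtain ⟨d, p, q, hp, hq, hx, rfl⟩ := exists_eq_germ a
  have hmem : ∀ b : LocalRingPN x, Ideal.Quotient.mk (idealOfX V x) b ∈ P ↔
      Ideal.Quotient.mk (idealOfX V x) (b * germ hp hq hx) ∈ stalkJ V F x := by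
    intro b
    rw [hu, Submodule.mem_colon_singleton, Submodule.mem_bot, ← Ideal.Quotient.eq_zero_iff_mem,
      map_mul, map_mul]
    rfl
  obtain ⟨i, hi⟩ := exists_X_mem_nonvanishing x
  have hX0 : Ideal.Quotient.mk (idealOfX V x)
      (germ (isHomogeneous_X ℂ 0) (isHomogeneous_X ℂ i) hi) ∈ P := by
    -- The point `P` lies in its own zero locus, so the inclusion of varieties puts the germs of
    -- `z₀` into `P`.
    have := hPz (show (⟨P, hprime⟩ : PrimeSpectrum _) ∈ PrimeSpectrum.zeroLocus _ from
      Set.Subset.rfl)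
    exact this ⟨_, ⟨⟨X i, isHomogeneous_X ℂ i⟩, hi, rfl⟩, rfl⟩
  rw [hmem, germ_mul_germ, germ_mem_stalkJ_iff] at hX0
  obtain ⟨e, c, hc, hcx, hJ⟩ := hX0
  refine ⟨x, _, c * p, hc.mul hp, by convert hJ using 1; ring, fun d' c' hc' hcx' hJ' => ?_⟩
  refine hprime.ne_top ((Ideal.eq_top_iff_one _).2 ?_)
  rw [← map_one (Ideal.Quotient.mk (idealOfX V x)), hmem, one_mul, germ_mem_stalkJ_iff]
  exact ⟨_, c' * c, hc'.mul hc, mul_mem hcx' hcx, by rwa [mul_assoc]⟩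

/-- Off `X`, a form that vanishes on `V` but not at `x` serves as `c`; on `V`, the power `z₀ ^ k`
does. At a point of `X_∞`, a nonzero class of `g` modulo the stalk would have its annihilator inside
an associated prime; that prime would contain `z₀ ^ k`, hence `z₀`, contrary to hypothesis. -/
theorem exists_mul_mem_of_not_hasAssociatedVarietyAtInfinity {V : Set (Fin N → ℂ)}
    {F : Fin m → MvPolynomial (Fin N) ℂ} (h : ¬ HasAssociatedVarietyAtInfinity V F) {e k : ℕ}
    {g : HomPoly N} (hg : g.IsHomogeneous e) (hk : X 0 ^ k * g ∈ divisionIdeal V F) (x : PN N) :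
    ∃ (d : ℕ) (c : HomPoly N), c.IsHomogeneous d ∧ c ∈ nonvanishing x ∧
      c * g ∈ divisionIdeal V F := by
  by_cases hxX : x ∈ projClosure V
  swap
  · simp only [projClosure, Set.mem_ofPred_eq, not_forall] at hxX
    obtain ⟨d, p, hp, hpV, hpx⟩ := hxX
    refine ⟨d, p, hp, hpx, Ideal.mul_mem_right _ _ (Ideal.mem_sup_left (Ideal.subset_span ?_))⟩
    exact ⟨d, hp, fun v hv => (evalAt_embed_eq_zero_iff hp v).1 (hpV v hv)⟩
  by_cases hxV : x ∈ embed '' V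
  · obtain ⟨v, -, rfl⟩ := hxV
    refine ⟨k, X 0 ^ k, isHomogeneous_X_pow 0 k, pow_mem (fun h0 => ?_) k, hk⟩
    rw [evalAt_embed_eq_zero_iff (isHomogeneous_X ℂ 0)] at h0
    simp at h0
  by_contra hcon
  obtain ⟨i, hi⟩ := exists_X_mem_nonvanishing x
  have hXi : ∀ d, (X i ^ d : HomPoly N).IsHomogeneous d := fun d => isHomogeneous_X_pow i d
  set u := Ideal.Quotient.mk (idealOfX V x) (germ hg (hXi e) (pow_mem hi e))
  have hu : Ideal.Quotient.mk (stalkJ V F x) u ≠ 0 := by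
    rw [Ne, Ideal.Quotient.eq_zero_iff_mem, germ_mem_stalkJ_iff]
    exact hcon
  obtain ⟨P, hP, hle⟩ :=
    exists_le_isAssociatedPrime_of_isNoetherianRing (LocalRingX V x) _ hu
  refine h ⟨x, ⟨hxX, hxV⟩, P, hP, PrimeSpectrum.zeroLocus_anti_mono ?_⟩
  rintro _ ⟨_, ⟨q, hq, rfl⟩, rfl⟩
  refine hP.isPrime.mem_of_pow_mem k (hle ?_)
  rw [Submodule.mem_colon_singleton, Submodule.mem_bot]
  have hq' : (q : HomPoly N).IsHomogeneous 1 := q.2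
  change Ideal.Quotient.mk (stalkJ V F x) (Ideal.Quotient.mk (idealOfX V x)
    (germ (isHomogeneous_X ℂ 0) hq' hq) ^ k * u) = 0
  rw [Ideal.Quotient.eq_zero_iff_mem, ← map_pow, ← map_mul, germ_pow, germ_mul_germ,
    germ_mem_stalkJ_iff]
  exact ⟨0, 1, isHomogeneous_one _ _, one_mem _, by rwa [one_mul]⟩

/-- An associated variety at infinity excludes a degree bound. -/
theorem HasAssociatedVarietyAtInfinity.not_isDegreeBound {V : Set (Fin N → ℂ)}
    {F : Fin m → MvPolynomial (Fin N) ℂ} (h : HasAssociatedVarietyAtInfinity V F) (β : ℤ) :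
    ¬ IsDegreeBound V F β := by
  intro hβ
  obtain ⟨x, e, g, hg, hX, hc⟩ := h.exists_form
  obtain ⟨i, hi⟩ := exists_X_mem_nonvanishing x
  have hXi : (X i ^ β.toNat : HomPoly N).IsHomogeneous β.toNat := isHomogeneous_X_pow i _
  refine hc _ (X i ^ β.toNat) hXi (pow_mem hi _) ?_
  refine hβ.isSaturatedInDegree (D := β.toNat + e) (by omega) _ (hXi.mul hg) 1 ?_
  rw [pow_one, mul_left_comm]
  exact Ideal.mul_mem_left _ _ hX

/-! ## Saturation in large degrees -/

theorem IsHomogeneous.mem_pow_idealOfVars {σ R : Type*} [CommRing R] {p : MvPolynomial σ R}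
    {d n : ℕ} (hp : p.IsHomogeneous d) (h : n ≤ d) : p ∈ idealOfVars σ R ^ n := by
  rw [mem_pow_idealOfVars_iff]
  intro s hs
  have := hp.degree_eq_sum_deg_support hs
  rw [← Finsupp.degree_apply] at this
  omega

/-- A homogeneous ideal that contains locally, at each point of `ℙᴺ`, the form `g`, contains the
products of `g` with all monomials of large degree. -/
theorem exists_pow_idealOfVars_mul_le (J : Ideal (HomPoly N)) {g : HomPoly N}
    (h : ∀ x : PN N, ∃ c, c ∈ nonvanishing x ∧ (∃ d, c.IsHomogeneous d) ∧ c * g ∈ J) :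
    ∃ n, ∀ p ∈ idealOfVars (Fin (N + 1)) ℂ ^ n, p * g ∈ J := by
  set I : Ideal (HomPoly N) := J.colon {g}
  have hI : ∀ p, p ∈ I ↔ p * g ∈ J := fun p => Submodule.mem_colon_singleton
  -- Nullstellensatz: the colon ideal `J : g` has no common zero other than possibly the origin,
  -- because at each point of `ℙᴺ` it contains a form that is nonzero there.
  have hrad : idealOfVars (Fin (N + 1)) ℂ ≤ I.radical := by
    refine Ideal.span_le.2 ?_
    rintro _ ⟨i, rfl⟩
    rw [SetLike.mem_coe, ← vanishingIdeal_zeroLocus_eq_radical (k := ℂ) (K := ℂ) I,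
      mem_vanishingIdeal_iff]
    intro v hv
    have hv0 : v = 0 := by
      by_contra hv0
      obtain ⟨c, hcx, ⟨d, hc⟩, hJ⟩ := h (Projectivization.mk ℂ v hv0)
      obtain ⟨a, ha⟩ := Projectivization.exists_smul_eq_mk_rep ℂ v hv0
      refine hcx ?_
      rw [evalAt, ← ha, Units.smul_def, IsHomogeneous.eval_smul hc]
      have := mem_zeroLocus_iff.1 hv c ((hI c).2 hJ)
      rw [aeval_eq_eval] at this
      simp [this]
    simp [hv0]
  obtain ⟨n, hn⟩ := Ideal.exists_pow_le_of_le_radical_of_fg hrad (idealOfVars_fg _ _)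
  exact ⟨n, fun p hp => (hI p).1 (hn hp)⟩

/-- If `J` contains each form `g` of its saturation with respect to `z₀` locally at all
points of `ℙᴺ`, then `J` is saturated with respect to `z₀` in all large degrees. -/
theorem exists_forall_isSaturatedInDegree {J : Ideal (HomPoly N)}
    (h : ∀ (e k : ℕ) (g : HomPoly N), g.IsHomogeneous e → X 0 ^ k * g ∈ J →
      ∀ x : PN N, ∃ c, c ∈ nonvanishing x ∧ (∃ d, c.IsHomogeneous d) ∧ c * g ∈ J) :
    ∃ D₀, ∀ D, D₀ ≤ D → IsSaturatedInDegree J D := by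
  classical
  -- `K` is the `z₀`-saturation; finitely many forms `g` of degrees `e g` generate it, each carried
  -- into `J` by the `n g`-th power of the irrelevant ideal.
  let K : Ideal (HomPoly N) := Ideal.span {g | (∃ e, g.IsHomogeneous e) ∧ ∃ k, X 0 ^ k * g ∈ J}
  obtain ⟨t, htK, ht⟩ := (Submodule.fg_span_iff_fg_span_finset_subset _).1
    (IsNoetherian.noetherian K)
  have hdata : ∀ g : t, ∃ e n : ℕ, (g : HomPoly N).IsHomogeneous e ∧
      ∀ p ∈ idealOfVars (Fin (N + 1)) ℂ ^ n, p * g ∈ J := by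
    intro g
    obtain ⟨⟨e, he⟩, k, hk⟩ := htK g.2
    obtain ⟨n, hn⟩ := exists_pow_idealOfVars_mul_le J (h e k g he hk)
    exact ⟨e, n, he, hn⟩
  choose e n he hn using hdata
  -- In these degrees the coefficient of each generator `g` may be taken homogeneous of degree `D -
  -- e g ≥ n g`.
  refine ⟨∑ g, (e g + n g), fun D hD g hg k hk => ?_⟩
  have hgK : g ∈ Submodule.span (HomPoly N) (t : Set (HomPoly N)) :=
    ht ▸ Ideal.subset_span ⟨⟨D, hg⟩, k, hk⟩
  obtain ⟨f, -, rfl⟩ := Submodule.mem_span_finset.1 hgK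
  rw [← IsHomogeneous.component_eq hg, map_sum]
  refine Ideal.sum_mem _ fun s hs => ?_
  have hs' := Finset.single_le_sum (f := fun g => e g + n g)
    (fun _ _ => Nat.zero_le _) (Finset.mem_univ (⟨s, hs⟩ : t))
  have hes := he ⟨s, hs⟩
  rw [smul_eq_mul, mul_comm, homogeneousComponent_mul_of_le hes (by omega), mul_comm]
  exact hn ⟨s, hs⟩ _ (IsHomogeneous.mem_pow_idealOfVars
    (homogeneousComponent_isHomogeneous _ _) (by omega))

theorem exists_forall_isSaturatedInDegree_divisionIdeal {V : Set (Fin N → ℂ)}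
    {F : Fin m → MvPolynomial (Fin N) ℂ} (h : ¬ HasAssociatedVarietyAtInfinity V F) :
    ∃ D₀, ∀ D, D₀ ≤ D → IsSaturatedInDegree (divisionIdeal V F) D := by
  refine exists_forall_isSaturatedInDegree fun e k g hg hk x => ?_
  obtain ⟨d, c, hc, hcx, hJ⟩ := exists_mul_mem_of_not_hasAssociatedVarietyAtInfinity h hg hk x
  exact ⟨c, hcx, ⟨d, hc⟩, hJ⟩

/-! ## Graded free modules -/

section Graded

variable {r s t : ℕ}

/-- The component of degree `e` of an element of `⨁ S (-a i)`. -/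
noncomputable def gradedComponent (a : Fin r → ℕ) (e : ℕ) :
    (Fin r → HomPoly N) →ₗ[ℂ] (Fin r → HomPoly N) :=
  LinearMap.pi fun i =>
    if a i ≤ e then homogeneousComponent (e - a i) ∘ₗ LinearMap.proj i else 0

theorem gradedComponent_apply (a : Fin r → ℕ) (e : ℕ) (v : Fin r → HomPoly N) (i : Fin r) :
    gradedComponent a e v i = if a i ≤ e then homogeneousComponent (e - a i) (v i) else 0 := by
  rw [gradedComponent, LinearMap.pi_apply]
  split_ifs <;> rfl

/-- Being fixed by `gradedComponent a e` serves as the definition of homogeneity of degree `e`;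
coordinates with `a i > e` are forced to vanish. -/
theorem gradedComponent_eq_self_iff {a : Fin r → ℕ} {e : ℕ} {v : Fin r → HomPoly N} :
    gradedComponent a e v = v ↔ ∀ i, v i ≠ 0 → ∃ k, a i + k = e ∧ (v i).IsHomogeneous k := by
  constructor
  · intro h i hi
    rw [← h, gradedComponent_apply] at hi ⊢
    split_ifs at hi ⊢ with hle
    · exact ⟨e - a i, by omega, homogeneousComponent_isHomogeneous _ _⟩
    · exact absurd rfl hi
  · intro h
    funext i
    rw [gradedComponent_apply]
    by_cases hi : v i = 0
    · simp [hi]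
    · obtain ⟨k, rfl, hk⟩ := h i hi
      rw [if_pos (Nat.le_add_right _ _), Nat.add_sub_cancel_left, IsHomogeneous.component_eq hk]

theorem gradedComponent_idem (a : Fin r → ℕ) (e : ℕ) (v : Fin r → HomPoly N) :
    gradedComponent a e (gradedComponent a e v) = gradedComponent a e v := by
  rw [gradedComponent_eq_self_iff]
  intro i hi
  rw [gradedComponent_apply] at hi ⊢
  split_ifs at hi ⊢ with hle
  · exact ⟨e - a i, by omega, homogeneousComponent_isHomogeneous _ _⟩
  · exact absurd rfl hi

theorem exists_sum_gradedComponent (a : Fin r → ℕ) (v : Fin r → HomPoly N) :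
    ∃ B, ∑ e ∈ Finset.range B, gradedComponent a e v = v := by
  refine ⟨∑ i, (a i + (v i).totalDegree + 1), ?_⟩
  set B := ∑ i, (a i + (v i).totalDegree + 1)
  funext i
  have hB : a i + (v i).totalDegree + 1 ≤ B :=
    Finset.single_le_sum (f := fun i => a i + (v i).totalDegree + 1)
      (fun _ _ => Nat.zero_le _) (Finset.mem_univ i)
  rw [Finset.sum_apply]
  simp only [gradedComponent_apply]
  rw [← Finset.sum_subset (s₁ := Finset.Ico (a i) B) (fun e he => by simp at he ⊢; omega)
    (fun e _ he' => if_neg fun h => he' (by simp at *; omega)), Finset.sum_Ico_eq_sum_range]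
  conv_rhs => rw [← sum_homogeneousComponent (v i)]
  symm
  refine (Finset.sum_subset (by simp; omega) fun e _ he => ?_).trans
    (Finset.sum_congr rfl fun e _ => by simp)
  exact homogeneousComponent_eq_zero _ _ (by simp at he; omega)

/-- The matrix `A` defines a graded map `⨁ S (-b j) → ⨁ S (-a i)`. -/
def IsGradedMatrix (a : Fin r → ℕ) (b : Fin s → ℕ) (A : Matrix (Fin r) (Fin s) (HomPoly N)) :
    Prop :=
  ∀ i j, A i j ≠ 0 → ∃ e, a i + e = b j ∧ (A i j).IsHomogeneous e

theorem isGradedMatrix_iff {a : Fin r → ℕ} {b : Fin s → ℕ}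
    {A : Matrix (Fin r) (Fin s) (HomPoly N)} :
    IsGradedMatrix a b A ↔ ∀ j, gradedComponent a (b j) (A.col j) = A.col j := by
  simp only [gradedComponent_eq_self_iff]
  exact forall_comm

theorem IsGradedMatrix.gradedComponent_mulVec {a : Fin r → ℕ} {b : Fin s → ℕ}
    {A : Matrix (Fin r) (Fin s) (HomPoly N)} (hA : IsGradedMatrix a b A) (e : ℕ)
    (v : Fin s → HomPoly N) :
    gradedComponent a e (A.mulVec v) = A.mulVec (gradedComponent b e v) := by
  funext i
  rw [gradedComponent_apply]
  simp only [Matrix.mulVec, dotProduct, gradedComponent_apply]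
  split_ifs with hi
  · rw [map_sum]
    refine Finset.sum_congr rfl fun j _ => ?_
    by_cases h0 : A i j = 0
    · simp [h0]
    obtain ⟨k, hk, hhom⟩ := hA i j h0
    split_ifs with hj
    · rw [homogeneousComponent_mul_of_le hhom (by omega),
        show e - a i - k = e - b j by omega]
    · rw [homogeneousComponent_mul_of_lt hhom (by omega), mul_zero]
  · refine (Finset.sum_eq_zero fun j _ => ?_).symm
    by_cases h0 : A i j = 0
    · simp [h0]
    obtain ⟨k, hk, -⟩ := hA i j h0
    rw [if_neg (by omega), mul_zero]

theorem mul_col (A : Matrix (Fin r) (Fin s) (HomPoly N)) (B : Matrix (Fin s) (Fin t) (HomPoly N))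
    (j : Fin t) : (A * B).col j = A.mulVec (B.col j) := rfl

theorem IsGradedMatrix.mul {a : Fin r → ℕ} {b : Fin s → ℕ} {c : Fin t → ℕ}
    {A : Matrix (Fin r) (Fin s) (HomPoly N)} {B : Matrix (Fin s) (Fin t) (HomPoly N)}
    (hA : IsGradedMatrix a b A) (hB : IsGradedMatrix b c B) : IsGradedMatrix a c (A * B) := by
  rw [isGradedMatrix_iff] at hB ⊢
  intro j
  rw [mul_col, hA.gradedComponent_mulVec, hB]

theorem isGradedMatrix_one (a : Fin r → ℕ) :
    IsGradedMatrix a a (1 : Matrix (Fin r) (Fin r) (HomPoly N)) := by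
  intro i j h
  obtain rfl : i = j := by
    by_contra hij
    exact h (Matrix.one_apply_ne hij)
  exact ⟨0, rfl, by simpa using isHomogeneous_one _ _⟩

/-- Coordinates of a homogeneous vector with nonzero constant coefficient belong to basis elements
of the same degree. -/
theorem eq_of_constantCoeff_ne_zero {a : Fin r → ℕ} {e : ℕ} {v : Fin r → HomPoly N}
    (hv : gradedComponent a e v = v) {i : Fin r} (hi : constantCoeff (v i) ≠ 0) : a i = e := by
  obtain ⟨k, hk, hhom⟩ := gradedComponent_eq_self_iff.1 hv i fun h0 => hi (by rw [h0, map_zero])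
  rw [constantCoeff_eq] at hi
  have : k = 0 := by
    by_contra hk0
    exact hi (hhom.coeff_eq_zero (by simpa using Ne.symm hk0))
  omega

theorem exists_mul_eq {D : Matrix (Fin r) (Fin s) (HomPoly N)}
    {A : Matrix (Fin r) (Fin t) (HomPoly N)} (h : ∀ j, ∃ w, A.col j = D.mulVec w) :
    ∃ L : Matrix (Fin s) (Fin t) (HomPoly N), D * L = A := by
  choose w hw using h
  refine ⟨Matrix.of fun i j => w j i, ?_⟩
  ext i j
  exact congrArg (fun f => coeff _ (f i)) (hw j).symm

/-- A lift of a homogeneous column may be replaced by its component of the degree of that column,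
since `D` commutes with taking components. -/
theorem exists_isGradedMatrix_mul_eq {a : Fin r → ℕ} {b : Fin s → ℕ} {c : Fin t → ℕ}
    {D : Matrix (Fin r) (Fin s) (HomPoly N)} (hD : IsGradedMatrix a b D)
    {A : Matrix (Fin r) (Fin t) (HomPoly N)} (hA : IsGradedMatrix a c A)
    (h : ∀ j, ∃ w, A.col j = D.mulVec w) :
    ∃ L : Matrix (Fin s) (Fin t) (HomPoly N), IsGradedMatrix b c L ∧ D * L = A := by
  choose w hw using h
  refine ⟨Matrix.of fun i j => gradedComponent b (c j) (w j) i, ?_, ?_⟩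
  · rw [isGradedMatrix_iff]
    exact fun j => gradedComponent_idem _ _ _
  · rw [isGradedMatrix_iff] at hA
    ext i j
    have : A.col j = D.mulVec (gradedComponent b (c j) (w j)) := by
      rw [← hD.gradedComponent_mulVec, ← hw, hA]
    exact congrArg (fun f => coeff _ (f i)) this.symm

theorem constantCoeff_mul_apply_of_left {A : Matrix (Fin r) (Fin s) (HomPoly N)}
    (hA : ∀ i j, constantCoeff (A i j) = 0) (B : Matrix (Fin s) (Fin t) (HomPoly N)) (i : Fin r)
    (j : Fin t) : constantCoeff ((A * B) i j) = 0 := by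
  simp [Matrix.mul_apply, hA]

theorem constantCoeff_mul_apply_of_right (A : Matrix (Fin r) (Fin s) (HomPoly N))
    {B : Matrix (Fin s) (Fin t) (HomPoly N)} (hB : ∀ i j, constantCoeff (B i j) = 0) (i : Fin r)
    (j : Fin t) : constantCoeff ((A * B) i j) = 0 := by
  simp [Matrix.mul_apply, hB]

end Graded

/-! ## Minimal generators of graded submodules -/

/-- A graded submodule of a graded free module of finite rank. -/
structure GradedSubmodule (N : ℕ) where
  /-- the rank of the ambient free module -/
  rank : ℕ
  /-- the degrees of its basis elements -/
  shift : Fin rank → ℕ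
  /-- the submodule -/
  carrier : Submodule (HomPoly N) (Fin rank → HomPoly N)
  gradedComponent_mem : ∀ e, ∀ v ∈ carrier, gradedComponent shift e v ∈ carrier

namespace GradedSubmodule

/-- The columns of `A`, of the degrees `b`, generate `M`. -/
def IsGenerating (M : GradedSubmodule N) {n : ℕ} (b : Fin n → ℕ)
    (A : Matrix (Fin M.rank) (Fin n) (HomPoly N)) : Prop :=
  IsGradedMatrix M.shift b A ∧ ∀ v, v ∈ M.carrier ↔ ∃ w, v = A.mulVec w

theorem exists_isGenerating (M : GradedSubmodule N) :
    ∃ (n : ℕ) (b : Fin n → ℕ) (A : Matrix (Fin M.rank) (Fin n) (HomPoly N)),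
      M.IsGenerating b A := by
  have hspan : Submodule.span (HomPoly N)
      {v | v ∈ M.carrier ∧ ∃ e, gradedComponent M.shift e v = v} = M.carrier := by
    refine le_antisymm (Submodule.span_le.2 fun v hv => hv.1) fun v hv => ?_
    obtain ⟨B, hB⟩ := exists_sum_gradedComponent M.shift v
    rw [← hB]
    exact Submodule.sum_mem _ fun e _ => Submodule.subset_span
      ⟨M.gradedComponent_mem e v hv, e, gradedComponent_idem _ _ _⟩
  obtain ⟨t, htM, ht⟩ := (Submodule.fg_span_iff_fg_span_finset_subset _).1
    (hspan.symm ▸ IsNoetherian.noetherian M.carrier)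
  rw [hspan] at ht
  choose b hb using fun v : t => (htM v.2).2
  let f := t.equivFin.symm
  refine ⟨_, fun j => b (f j), Matrix.of fun i j => (f j : Fin M.rank → HomPoly N) i,
    isGradedMatrix_iff.2 fun j => hb (f j), fun v => ?_⟩
  have hmul : ∀ w : Fin t.card → HomPoly N,
      (Matrix.of fun i j => (f j : Fin M.rank → HomPoly N) i).mulVec w =
        ∑ j, w j • (f j : Fin M.rank → HomPoly N) := by
    intro w
    funext i
    simp [Matrix.mulVec, dotProduct, mul_comm]
  have hrange : (t : Set (Fin M.rank → HomPoly N)) =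
      Set.range fun j => (f j : Fin M.rank → HomPoly N) := by
    ext v
    constructor
    · intro hv
      exact ⟨f.symm ⟨v, hv⟩, by simp⟩
    · rintro ⟨j, rfl⟩
      exact (f j).2
  simp only [hmul]
  rw [ht, hrange, Submodule.mem_span_range_iff_exists_fun]
  exact exists_congr fun w => eq_comm

/-- The component of degree `b j` of the relation `w` is again a relation, and its `j`-th coordinate
is a nonzero constant. It expresses column `j` through the other columns. -/
theorem IsGenerating.remove {M : GradedSubmodule N} {n : ℕ} {b : Fin (n + 1) → ℕ}
    {A : Matrix (Fin M.rank) (Fin (n + 1)) (HomPoly N)} (h : M.IsGenerating b A)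
    {w : Fin (n + 1) → HomPoly N} (hw : A.mulVec w = 0) {j : Fin (n + 1)}
    (hj : constantCoeff (w j) ≠ 0) :
    M.IsGenerating (fun i => b (j.succAbove i)) (A.submatrix id j.succAbove) := by
  have hw' : A.mulVec (gradedComponent b (b j) w) = 0 := by
    rw [← h.1.gradedComponent_mulVec, hw, map_zero]
  set w' := gradedComponent b (b j) w
  have hw'j : w' j = C (constantCoeff (w j)) := by
    simp [w', gradedComponent_apply, homogeneousComponent_zero, constantCoeff_eq]
  have hmul : ∀ v : Fin (n + 1) → HomPoly N, v j = 0 →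
      A.mulVec v = (A.submatrix id j.succAbove).mulVec fun i => v (j.succAbove i) := by
    intro v hv
    funext i
    simp [Matrix.mulVec, dotProduct, Fin.sum_univ_succAbove _ j, hv]
  refine ⟨fun i k hik => h.1 i _ hik, fun v => (h.2 v).trans ⟨?_, ?_⟩⟩
  · rintro ⟨u, rfl⟩
    have : A.mulVec u = A.mulVec (u - (u j * C (constantCoeff (w j))⁻¹) • w') := by
      rw [Matrix.mulVec_sub, Matrix.mulVec_smul, hw', smul_zero, sub_zero]
    refine ⟨_, this.trans (hmul _ ?_)⟩
    simp only [Pi.sub_apply, Pi.smul_apply, smul_eq_mul, hw'j]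
    rw [mul_assoc, ← C_mul, inv_mul_cancel₀ hj, C_1, mul_one, sub_self]
  · rintro ⟨u, rfl⟩
    refine ⟨j.insertNth (0 : HomPoly N) u, ?_⟩
    rw [hmul _ (by simp)]
    simp

/-- With the least possible number of homogeneous generators, no relation can have a nonzero
constant coefficient: `IsGenerating.remove` would discard a generator. -/
theorem exists_minimal_isGenerating (M : GradedSubmodule N) :
    ∃ (n : ℕ) (b : Fin n → ℕ) (A : Matrix (Fin M.rank) (Fin n) (HomPoly N)),
      M.IsGenerating b A ∧ ∀ w, A.mulVec w = 0 → ∀ j, constantCoeff (w j) = 0 := by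
  classical
  obtain ⟨b, A, h⟩ := Nat.find_spec M.exists_isGenerating
  refine ⟨_, b, A, h, fun w hw j => ?_⟩
  by_contra hj
  generalize hn : Nat.find M.exists_isGenerating = n at b A h w j
  cases n with
  | zero => exact j.elim0
  | succ n =>
    exact Nat.find_min M.exists_isGenerating (m := n) (by omega) ⟨_, _, h.remove hw hj⟩

/-- The number of minimal generators. -/
noncomputable def numGens (M : GradedSubmodule N) : ℕ :=
  M.exists_minimal_isGenerating.choose

/-- The degrees of minimal generators. -/
noncomputable def genDegree (M : GradedSubmodule N) : Fin M.numGens → ℕ :=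
  M.exists_minimal_isGenerating.choose_spec.choose

/-- The matrix whose columns are minimal generators. -/
noncomputable def genMatrix (M : GradedSubmodule N) :
    Matrix (Fin M.rank) (Fin M.numGens) (HomPoly N) :=
  M.exists_minimal_isGenerating.choose_spec.choose_spec.choose

theorem genMatrix_isGenerating (M : GradedSubmodule N) :
    M.IsGenerating M.genDegree M.genMatrix :=
  M.exists_minimal_isGenerating.choose_spec.choose_spec.choose_spec.1

theorem constantCoeff_eq_zero_of_genMatrix_mulVec (M : GradedSubmodule N)
    {w : Fin M.numGens → HomPoly N} (h : M.genMatrix.mulVec w = 0) (j : Fin M.numGens) :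
    constantCoeff (w j) = 0 :=
  M.exists_minimal_isGenerating.choose_spec.choose_spec.choose_spec.2 w h j

/-- The module of relations between the minimal generators. -/
noncomputable def syzygies (M : GradedSubmodule N) : GradedSubmodule N where
  rank := M.numGens
  shift := M.genDegree
  carrier := LinearMap.ker M.genMatrix.mulVecLin
  gradedComponent_mem := by
    intro e v hv
    rw [LinearMap.mem_ker, Matrix.mulVecLin_apply] at hv ⊢
    rw [← M.genMatrix_isGenerating.1.gradedComponent_mulVec, hv, map_zero]

/-- A homogeneous ideal as a graded submodule of `S`. -/
noncomputable def ofIdeal (J : Ideal (HomPoly N)) (hJ : J.IsHomogeneous (forms N)) :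
    GradedSubmodule N where
  rank := 1
  shift := fun _ => 0
  carrier := Submodule.comap (LinearMap.proj (0 : Fin 1)) J
  gradedComponent_mem := by
    intro e v hv
    rw [Submodule.mem_comap, LinearMap.proj_apply] at hv ⊢
    rw [gradedComponent_apply, if_pos (Nat.zero_le _)]
    exact homogeneousComponent_mem_of_mem hJ hv _

/-- The iterated syzygies. -/
noncomputable def iteratedSyzygies (M : GradedSubmodule N) : ℕ → GradedSubmodule N
  | 0 => M
  | k + 1 => (M.iteratedSyzygies k).syzygies

end GradedSubmodule

theorem nonempty_minimalGradedFreeResolution (J : Ideal (HomPoly N))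
    (hJ : J.IsHomogeneous (forms N)) : Nonempty (MinimalGradedFreeResolution J) := by
  set M := GradedSubmodule.ofIdeal J hJ
  have hexact : ∀ k (v : Fin (M.iteratedSyzygies (k + 1)).rank → HomPoly N),
      (M.iteratedSyzygies k).genMatrix.mulVec v = 0 ↔
        ∃ w, v = (M.iteratedSyzygies (k + 1)).genMatrix.mulVec w := fun k v =>
    (M.iteratedSyzygies (k + 1)).genMatrix_isGenerating.2 v
  have hgen := M.genMatrix_isGenerating
  let g : Fin M.numGens → HomPoly N := fun i => M.genMatrix (0 : Fin 1) i
  have hmul : ∀ w, M.genMatrix.mulVec w = fun _ => ∑ i, w i * g i := by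
    intro w
    funext i
    obtain rfl : i = (0 : Fin 1) := Subsingleton.elim (α := Fin 1) _ _
    simp [Matrix.mulVec, dotProduct, mul_comm, g]
  -- The index is shifted by one because the zeroth module `J` lies in `S` itself: `F_k` is the free
  -- module on the minimal generators of the `k`-th syzygies, the ambient module of the next ones.
  exact ⟨{
    rank := fun k => (M.iteratedSyzygies (k + 1)).rank
    shift := fun k => (M.iteratedSyzygies (k + 1)).shift
    gen := g
    diff := fun k => (M.iteratedSyzygies (k + 1)).genMatrix
    gen_homogeneous := fun i => by
      by_cases h0 : g i = 0
      · rw [h0]; exact isHomogeneous_zero _ _ _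
      · obtain ⟨e, he, hhom⟩ := hgen.1 (0 : Fin 1) i h0
        obtain rfl : e = M.genDegree i := (Nat.zero_add e).symm.trans he
        exact hhom
    diff_homogeneous := fun k i j h => (M.iteratedSyzygies (k + 1)).genMatrix_isGenerating.1 i j h
    span_gen := by
      ext p
      refine Ideal.mem_span_range_iff_exists_fun.trans (Iff.trans ?_ (hgen.2 fun _ => p).symm)
      refine exists_congr fun w => ⟨fun h => ?_, fun h => ?_⟩
      · exact Eq.trans (funext fun _ => h.symm) (hmul w).symm
      · exact (congrFun (h.trans (hmul w)) (0 : Fin 1)).symm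
    exact_gen := fun v => by
      refine Iff.trans ⟨fun h => ?_, fun h => ?_⟩ (hexact 0 v)
      · exact (hmul v).trans (funext fun _ => h)
      · exact congrFun ((hmul v).symm.trans h) (0 : Fin 1)
    exact_diff := fun k v => hexact (k + 1) v
    -- Columns of this matrix are relations between minimal generators, so they have no constant
    -- terms.
    minimal := fun k i j => by
      refine (M.iteratedSyzygies k).constantCoeff_eq_zero_of_genMatrix_mulVec
        (w := (M.iteratedSyzygies (k + 1)).genMatrix.col j) ?_ i
      refine (hexact k _).2 ⟨Pi.single j 1, ?_⟩
      exact (Matrix.mulVec_single_one _ _).symm }⟩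

/-! ## Graded free resolutions -/

/-- A complex `⋯ → G₂ → G₁ → G₀` of graded free modules of finite rank, exact at `G₁, G₂, …`. -/
structure GradedFreeComplex (N : ℕ) where
  /-- the rank of `G_k` -/
  rank : ℕ → ℕ
  /-- the degrees of the basis elements of `G_k` -/
  shift : (k : ℕ) → Fin (rank k) → ℕ
  /-- the matrix of `G_{k+1} → G_k` -/
  diff : (k : ℕ) → Matrix (Fin (rank k)) (Fin (rank (k + 1))) (HomPoly N)
  diff_graded : ∀ k, IsGradedMatrix (shift k) (shift (k + 1)) (diff k)
  exact : ∀ k v, (diff k).mulVec v = 0 ↔ ∃ w, v = (diff (k + 1)).mulVec w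

/-- The resolution `⋯ → F₁ → F₀ → S` of `S / J`. -/
def MinimalGradedFreeResolution.augmented {J : Ideal (HomPoly N)}
    (E : MinimalGradedFreeResolution J) : GradedFreeComplex N where
  rank
    | 0 => 1
    | k + 1 => E.rank k
  shift
    | 0 => fun _ => 0
    | k + 1 => E.shift k
  diff
    | 0 => Matrix.of fun _ i => E.gen i
    | k + 1 => E.diff k
  diff_graded
    | 0 => fun _ i _ => ⟨E.shift 0 i, Nat.zero_add _, E.gen_homogeneous i⟩
    | k + 1 => E.diff_homogeneous k
  exact
    | 0 => fun v => by
      refine Iff.trans ?_ (E.exact_gen v)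
      constructor
      · intro h
        have := congrFun h (0 : Fin 1)
        simpa [Matrix.mulVec, dotProduct, mul_comm] using this
      · intro h
        funext i
        simpa [Matrix.mulVec, dotProduct, mul_comm] using h
    | k + 1 => E.exact_diff k

theorem MinimalGradedFreeResolution.exists_augmented_mulVec_iff {J : Ideal (HomPoly N)}
    (E : MinimalGradedFreeResolution J) (p : HomPoly N) :
    (∃ w, (fun _ => p) = (E.augmented.diff 0).mulVec w) ↔ p ∈ J := by
  refine Iff.trans ?_ (E.span_gen ▸ Ideal.mem_span_range_iff_exists_fun.symm)
  refine exists_congr fun w => ⟨fun h => ?_, fun h => ?_⟩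
  · have := congrFun h (0 : Fin 1)
    rw [this]
    simp only [augmented, Matrix.mulVec, dotProduct, mul_comm]
    rfl
  · funext i
    rw [← h]
    simp only [augmented, Matrix.mulVec, dotProduct, mul_comm]
    rfl

namespace GradedFreeComplex

theorem diff_mul_diff (A : GradedFreeComplex N) (k : ℕ) : A.diff k * A.diff (k + 1) = 0 := by
  ext i j
  have := (A.exact k _).2 ⟨Pi.single j 1, rfl⟩
  rw [Matrix.mulVec_mulVec, Matrix.mulVec_single_one] at this
  exact congrArg (coeff _) (congrFun this i)

/-- Comparison maps in degree `k` between two complexes, and a homotopy, as they are needed to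
extend the comparison to degree `k + 1`. -/
def HasComparison (A B : GradedFreeComplex N) (k : ℕ) : Prop :=
  ∃ (α : Matrix (Fin (B.rank k)) (Fin (A.rank k)) (HomPoly N))
    (β : Matrix (Fin (A.rank k)) (Fin (B.rank k)) (HomPoly N))
    (h : Matrix (Fin (A.rank (k + 1))) (Fin (A.rank k)) (HomPoly N)),
    IsGradedMatrix (B.shift k) (A.shift k) α ∧ IsGradedMatrix (A.shift k) (B.shift k) β ∧
    (∀ v, ∃ w, α.mulVec ((A.diff k).mulVec v) = (B.diff k).mulVec w) ∧
    (∀ v, ∃ w, β.mulVec ((B.diff k).mulVec v) = (A.diff k).mulVec w) ∧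
    -- The homotopy relation is stated after composition with the differential; this kills the term
    -- coming from the previous homotopy, which then need not be recorded.
    (β * α - 1 - A.diff k * h) * A.diff k = 0 ∧
    (∀ i j, constantCoeff ((h * A.diff k) i j) = 0)

/-- In place `k + 1` the lifted maps satisfy `β' α' = 1 + h d + d h'`, where both corrections have
no constant terms. A diagonal entry of `β' α'` thus has constant coefficient 1, so each column `i`
of `α'` has an entry with nonzero constant coefficient; as `α'` is graded, that entry joins basis
elements of equal degree. -/
theorem HasComparison.succ {A B : GradedFreeComplex N} {k : ℕ} (h : HasComparison A B k)
    (hmin : ∀ i j, constantCoeff (A.diff (k + 1) i j) = 0) :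
    HasComparison A B (k + 1) ∧
      ∀ i, ∃ l, B.shift (k + 1) l = A.shift (k + 1) i := by
  obtain ⟨α, β, h, hα, hβ, hαd, hβd, hhom, hconst⟩ := h
  obtain ⟨α', hα', hdα⟩ := exists_isGradedMatrix_mul_eq (B.diff_graded k)
    (hα.mul (A.diff_graded k)) fun j => by
      obtain ⟨w, hw⟩ := hαd (Pi.single j 1)
      exact ⟨w, by rw [← hw, Matrix.mulVec_mulVec, Matrix.mulVec_single_one]⟩
  obtain ⟨β', hβ', hdβ⟩ := exists_isGradedMatrix_mul_eq (A.diff_graded k)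
    (hβ.mul (B.diff_graded k)) fun j => by
      obtain ⟨w, hw⟩ := hβd (Pi.single j 1)
      exact ⟨w, by rw [← hw, Matrix.mulVec_mulVec, Matrix.mulVec_single_one]⟩
  have hzero : A.diff k * (β' * α' - 1 - h * A.diff k) = 0 := by
    have e : A.diff k * (β' * α') = β * α * A.diff k := by
      rw [← Matrix.mul_assoc, hdβ, Matrix.mul_assoc, hdα, Matrix.mul_assoc]
    rw [← hhom, Matrix.mul_sub, Matrix.mul_sub, Matrix.mul_one, e, Matrix.sub_mul, Matrix.sub_mul,
      Matrix.one_mul, Matrix.mul_assoc (A.diff k)]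
  obtain ⟨h', hh'⟩ := exists_mul_eq (D := A.diff (k + 1)) (A := β' * α' - 1 - h * A.diff k)
    fun j => (A.exact k _).1 (by rw [← mul_col, hzero]; rfl)
  have hAA := A.diff_mul_diff k
  have hBB := B.diff_mul_diff k
  refine ⟨⟨α', β', h', hα', hβ', fun v => ?_, fun v => ?_, ?_, ?_⟩, fun i => ?_⟩
  · refine (B.exact k _).1 ?_
    rw [Matrix.mulVec_mulVec, Matrix.mulVec_mulVec, hdα, Matrix.mul_assoc,
      hAA, Matrix.mul_zero, Matrix.zero_mulVec]
  · refine (A.exact k _).1 ?_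
    rw [Matrix.mulVec_mulVec, Matrix.mulVec_mulVec, hdβ, Matrix.mul_assoc,
      hBB, Matrix.mul_zero, Matrix.zero_mulVec]
  · rw [hh', sub_sub_cancel, Matrix.mul_assoc, hAA, Matrix.mul_zero]
  · exact constantCoeff_mul_apply_of_right _ hmin
  · have h1 : constantCoeff ((β' * α') i i) = 1 := by
      have e : β' * α' = 1 + h * A.diff k + A.diff (k + 1) * h' := by rw [hh']; abel
      rw [e, Matrix.add_apply, Matrix.add_apply, map_add, map_add, hconst,
        constantCoeff_mul_apply_of_left hmin]
      simp
    obtain ⟨l, -, hl⟩ := Finset.exists_ne_zero_of_sum_ne_zero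
      (show ∑ l, constantCoeff (β' i l * α' l i) ≠ 0 by
        rw [← map_sum, ← Matrix.mul_apply, h1]; exact one_ne_zero)
    rw [map_mul] at hl
    exact ⟨l, eq_of_constantCoeff_ne_zero (isGradedMatrix_iff.1 hα' i) (right_ne_zero_of_mul hl)⟩

end GradedFreeComplex

theorem MinimalGradedFreeResolution.hasComparison {J : Ideal (HomPoly N)}
    (E R : MinimalGradedFreeResolution J) (k : ℕ) :
    GradedFreeComplex.HasComparison E.augmented R.augmented k := by
  induction k with
  | zero =>
    have key : ∀ (E R : MinimalGradedFreeResolution J) v, ∃ w,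
        (1 : Matrix (Fin 1) (Fin 1) (HomPoly N)).mulVec ((E.augmented.diff 0).mulVec v) =
          (R.augmented.diff 0).mulVec w := by
      intro E R v
      have hv : (fun _ => (E.augmented.diff 0).mulVec v (0 : Fin 1)) =
          (E.augmented.diff 0).mulVec v := by
        funext i
        exact congrArg _ (Subsingleton.elim (α := Fin 1) _ _)
      obtain ⟨w, hw⟩ := (R.exists_augmented_mulVec_iff _).2
        ((E.exists_augmented_mulVec_iff _).1 ⟨v, hv⟩)
      exact ⟨w, (Matrix.one_mulVec _).trans (hv.symm.trans hw)⟩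
    -- The homotopy must start at zero: the generators of `J` may have constant terms (if `J = S`),
    -- so minimality says nothing about the first differential.
    refine ⟨(1 : Matrix (Fin 1) (Fin 1) (HomPoly N)), (1 : Matrix (Fin 1) (Fin 1) (HomPoly N)), 0,
      isGradedMatrix_one _, isGradedMatrix_one _, key E R, key R E, ?_, fun i j => ?_⟩
    · rw [Matrix.mul_zero, sub_zero]
      have : (1 : Matrix (Fin 1) (Fin 1) (HomPoly N)) * 1 - 1 = 0 := by
        rw [Matrix.mul_one, sub_self]
      exact (congrArg
        (fun B : Matrix (Fin (E.augmented.rank 0)) (Fin (E.augmented.rank 0)) (HomPoly N) => B * E.augmented.diff 0) this).trans (Matrix.zero_mul _)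
    · rw [Matrix.zero_mul]; exact map_zero _
  | succ k ih => exact (ih.succ (E.minimal k)).1

/-- The degrees of the basis elements are the same in all minimal resolutions. -/
theorem MinimalGradedFreeResolution.exists_shift_eq {J : Ideal (HomPoly N)}
    (E R : MinimalGradedFreeResolution J) (k : ℕ) (i : Fin (E.rank k)) :
    ∃ l, R.shift k l = E.shift k i :=
  ((E.hasComparison R k).succ (E.minimal k)).2 i

/-! ## Reduction modulo a regular sequence -/

section ExactMod

variable {R : Type*} [CommRing R] {r s t u : ℕ}

/-- `R^t → R^s → R^r` is exact modulo the ideal `I`. -/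
def ExactMod (I : Ideal R) (A : Matrix (Fin r) (Fin s) R) (B : Matrix (Fin s) (Fin t) R) : Prop :=
  ∀ v, (∀ i, A.mulVec v i ∈ I) → ∃ w, ∀ i, (v - B.mulVec w) i ∈ I

theorem mulVec_mem {I : Ideal R} (A : Matrix (Fin r) (Fin s) R) {v : Fin s → R}
    (hv : ∀ i, v i ∈ I) (i : Fin r) : A.mulVec v i ∈ I :=
  sum_mem (t := Finset.univ) fun j _ => I.mul_mem_left (A i j) (hv j)

theorem exists_eq_smul_add_of_mem_sup_span {I : Ideal R} {x : R} {v : Fin r → R}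
    (hv : ∀ i, v i ∈ I ⊔ Ideal.span {x}) : ∃ w, ∀ i, (v - x • w) i ∈ I := by
  have : ∀ i, ∃ w, v i - x * w ∈ I := by
    intro i
    obtain ⟨a, ha, b, hb, hab⟩ := Submodule.mem_sup.1 (hv i)
    obtain ⟨w, rfl⟩ := Ideal.mem_span_singleton'.1 hb
    exact ⟨w, by rw [← hab]; convert ha using 1; ring⟩
  choose w hw using this
  exact ⟨w, hw⟩

/-- If `B v ≡ x w` modulo `I`, then `x A w ∈ I`, so `A w ∈ I` by regularity and `w ≡ B y`. Now `B (v
- x y) ∈ I`, so `v - x y` comes from `C`. Two adjacent exact places are consumed, so one place is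
lost for each new element. -/
theorem ExactMod.sup_span {I : Ideal R} {x : R} (hx : ∀ a, x * a ∈ I → a ∈ I)
    {A : Matrix (Fin r) (Fin s) R} {B : Matrix (Fin s) (Fin t) R} {C : Matrix (Fin t) (Fin u) R}
    (hAB : A * B = 0) (h₁ : ExactMod I A B) (h₂ : ExactMod I B C) :
    ExactMod (I ⊔ Ideal.span {x}) B C := by
  intro v hv
  obtain ⟨w, hw⟩ := exists_eq_smul_add_of_mem_sup_span hv
  have hAw : ∀ i, A.mulVec w i ∈ I := by
    intro i
    refine hx _ ?_
    have := mulVec_mem A hw i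
    rw [Matrix.mulVec_sub, Matrix.mulVec_mulVec, hAB, Matrix.zero_mulVec, zero_sub,
      Matrix.mulVec_smul, Pi.neg_apply, neg_mem_iff] at this
    exact this
  obtain ⟨y, hy⟩ := h₁ w hAw
  obtain ⟨z, hz⟩ := h₂ (v - x • y) fun i => by
    have : B.mulVec (v - x • y) i = (B.mulVec v - x • w) i + x * (w - B.mulVec y) i := by
      simp only [Matrix.mulVec_sub, Matrix.mulVec_smul, Pi.sub_apply, Pi.smul_apply, smul_eq_mul]
      ring
    rw [this]
    exact add_mem (hw i) (Ideal.mul_mem_left _ _ (hy i))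
  refine ⟨z, fun i => ?_⟩
  have : (v - C.mulVec z) i = (v - x • y - C.mulVec z) i + x * y i := by
    simp only [Pi.sub_apply, Pi.smul_apply, smul_eq_mul]
    ring
  rw [this]
  exact add_mem (Ideal.mem_sup_left (hz i)) (Ideal.mem_sup_right
    (Ideal.mul_mem_right _ _ (Ideal.mem_span_singleton_self x)))

end ExactMod

/-- The ideal generated by the first `j` variables. -/
noncomputable def firstVars (N j : ℕ) : Ideal (HomPoly N) :=
  Ideal.span (X '' {i : Fin (N + 1) | i.1 < j})

theorem firstVars_zero : firstVars N 0 = ⊥ := by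
  simp [firstVars]

theorem firstVars_succ (i : Fin (N + 1)) :
    firstVars N (i.1 + 1) = firstVars N i.1 ⊔ Ideal.span {X i} := by
  rw [firstVars, firstVars, ← Ideal.span_union, ← Set.image_singleton, ← Set.image_union]
  congr 2
  ext k
  simp only [Set.mem_ofPred_eq, Set.mem_union, Set.mem_singleton_iff, Fin.ext_iff]
  omega

theorem firstVars_isHomogeneous (j : ℕ) : (firstVars N j).IsHomogeneous (forms N) := by
  apply Ideal.homogeneous_span
  rintro _ ⟨i, -, rfl⟩
  exact ⟨1, isHomogeneous_X ℂ i⟩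

theorem mem_firstVars_of_X_mul_mem (i : Fin (N + 1)) {a : HomPoly N}
    (h : X i * a ∈ firstVars N i.1) : a ∈ firstVars N i.1 := by
  rw [firstVars, mem_ideal_span_X_image] at h ⊢
  intro s hs
  obtain ⟨k, hk, hsk⟩ := h (Finsupp.single i 1 + s) (by
    rw [mem_support_iff, coeff_X_mul]; exact mem_support_iff.1 hs)
  refine ⟨k, hk, ?_⟩
  have hik : i ≠ k := by
    rintro rfl
    exact lt_irrefl i.1 hk
  simpa [Finsupp.single_apply, hik] using hsk

theorem mem_firstVars_iff_constantCoeff {a : HomPoly N} :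
    a ∈ firstVars N (N + 1) ↔ constantCoeff a = 0 := by
  rw [firstVars, mem_ideal_span_X_image, constantCoeff_eq]
  constructor
  · intro h
    by_contra h0
    obtain ⟨i, -, hi⟩ := h 0 (mem_support_iff.2 h0)
    exact hi rfl
  · intro h s hs
    have hs0 : s ≠ 0 := by
      rintro rfl
      exact mem_support_iff.1 hs h
    obtain ⟨i, hi⟩ := Finsupp.ne_iff.1 hs0
    exact ⟨i, i.2, hi⟩

/-- This is the vanishing of Tor with `S / (z₀, …, z_{j-1})` above degree `j`, obtained by adding
the variables of the regular sequence one at a time. -/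
theorem GradedFreeComplex.exactMod_firstVars (A : GradedFreeComplex N) {j : ℕ} (hj : j ≤ N + 1)
    {k : ℕ} (hk : j ≤ k) : ExactMod (firstVars N j) (A.diff k) (A.diff (k + 1)) := by
  induction j generalizing k with
  | zero =>
    intro v hv
    simp only [firstVars_zero, Ideal.mem_bot] at hv ⊢
    obtain ⟨w, hw⟩ := (A.exact k v).1 (funext hv)
    exact ⟨w, fun i => by rw [← hw, sub_self, Pi.zero_apply]⟩
  | succ j ih =>
    obtain ⟨k, rfl⟩ : ∃ k', k = k' + 1 := ⟨k - 1, by omega⟩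
    rw [firstVars_succ ⟨j, by omega⟩]
    exact ExactMod.sup_span (fun a => mem_firstVars_of_X_mul_mem ⟨j, by omega⟩)
      (A.diff_mul_diff k) (ih (by omega) (by omega)) (ih (by omega) (by omega))

/-- Hilbert's syzygy theorem: a minimal resolution of an ideal has length at most `N`. -/
theorem MinimalGradedFreeResolution.rank_eq_zero {J : Ideal (HomPoly N)}
    (E : MinimalGradedFreeResolution J) {k : ℕ} (hk : N < k) : E.rank k = 0 := by
  obtain ⟨k, rfl⟩ : ∃ k', k = k' + 1 := ⟨k - 1, by omega⟩
  have hmem : ∀ k i j, E.diff k i j ∈ firstVars N (N + 1) := fun k i j =>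
    mem_firstVars_iff_constantCoeff.2 (E.minimal k i j)
  have hmul : ∀ k w i, (E.diff k).mulVec w i ∈ firstVars N (N + 1) := fun k w i =>
    sum_mem (t := Finset.univ) fun j _ => Ideal.mul_mem_right (w j) _ (hmem k i j)
  by_contra h0
  let i₀ : Fin (E.rank (k + 1)) := ⟨0, Nat.pos_of_ne_zero h0⟩
  -- Modulo all variables the differentials of a minimal resolution vanish while exactness persists
  -- in this place, so a basis vector would be zero modulo the variables.
  obtain ⟨w, hw⟩ := E.augmented.exactMod_firstVars le_rfl (k := k + 1) (by omega)
    (Pi.single i₀ (1 : HomPoly N)) (hmul k _)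
  have h1 := add_mem (hw i₀) (hmul (k + 1) w i₀)
  have h2 : (Pi.single i₀ (1 : HomPoly N) : Fin (E.rank (k + 1)) → HomPoly N) i₀ ∈
      firstVars N (N + 1) := by
    convert h1 using 1
    exact (sub_add_cancel _ _).symm
  rw [Pi.single_eq_same, mem_firstVars_iff_constantCoeff, map_one] at h2
  exact one_ne_zero h2

/-! ### Socle elements and the last module of a resolution -/

theorem gradedComponent_X_smul {r : ℕ} {a : Fin r → ℕ} {e : ℕ} {v : Fin r → HomPoly N}
    (hv : gradedComponent a e v = v) (i : Fin (N + 1)) :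
    gradedComponent a (e + 1) ((X i : HomPoly N) • v) = (X i : HomPoly N) • v := by
  rw [gradedComponent_eq_self_iff] at hv ⊢
  intro l hl
  obtain ⟨k, hk, hhom⟩ := hv l (right_ne_zero_of_mul hl)
  exact ⟨k + 1, by omega, add_comm 1 k ▸ (isHomogeneous_X ℂ i).mul hhom⟩

theorem gradedComponent_mem_of_forall_mem {r : ℕ} {I : Ideal (HomPoly N)}
    (hI : I.IsHomogeneous (forms N)) (a : Fin r → ℕ) (e : ℕ) {v : Fin r → HomPoly N}
    (hv : ∀ i, v i ∈ I) (i : Fin r) : gradedComponent a e v i ∈ I := by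
  rw [gradedComponent_apply]
  split_ifs
  · exact homogeneousComponent_mem_of_mem hI (hv i) _
  · exact I.zero_mem

/-- A form `u` of degree `d` that represents a nonzero element of the socle of `S / J` gives rise,
for `j ≤ N + 1`, to elements of degree `d + j` of the `j`-th module of the resolution. -/
theorem GradedFreeComplex.exists_of_socle (A : GradedFreeComplex N) {d : ℕ}
    {c₀ : Fin (A.rank 0) → HomPoly N} (hc₀ : gradedComponent (A.shift 0) d c₀ = c₀)
    (hX : ∀ i : Fin (N + 1), ∃ y, (X i : HomPoly N) • c₀ = (A.diff 0).mulVec y)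
    (hne : ¬ ∃ y, c₀ = (A.diff 0).mulVec y) {j : ℕ} (hj : j ≤ N + 1) :
    ∃ c : Fin (A.rank j) → HomPoly N, gradedComponent (A.shift j) (d + j) c = c ∧
      (∀ i : Fin (N + 1), ∃ y, ∀ l, ((X i : HomPoly N) • c - (A.diff j).mulVec y) l ∈
        firstVars N j) ∧
      ¬ ∃ y, ∀ l, (c - (A.diff j).mulVec y) l ∈ firstVars N j := by
  induction j with
  | zero =>
    refine ⟨c₀, hc₀, fun i => ?_, fun ⟨y, hy⟩ => hne ⟨y, ?_⟩⟩
    · obtain ⟨y, hy⟩ := hX i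
      exact ⟨y, fun l => by rw [hy, sub_self]; exact zero_mem _⟩
    · simp only [firstVars_zero, Ideal.mem_bot] at hy
      exact sub_eq_zero.1 (funext hy)
  | succ j ih =>
    obtain ⟨c, hc, hcX, hcne⟩ := ih (by omega)
    let z : Fin (N + 1) := ⟨j, by omega⟩
    -- Since `z_j c` is a boundary modulo the earlier variables, a preimage in the next module, cut
    -- to degree `d + j + 1`, is the new element: an inverse of the connecting map for
    -- multiplication by `z_j`.
    obtain ⟨y₀, hy₀⟩ := hcX z
    have hy : ∀ l, ((X z : HomPoly N) • c -
        (A.diff j).mulVec (gradedComponent (A.shift (j + 1)) (d + (j + 1)) y₀)) l ∈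
          firstVars N j := by
      have := gradedComponent_mem_of_forall_mem (firstVars_isHomogeneous j) (A.shift j)
        (d + j + 1) hy₀
      rwa [map_sub, gradedComponent_X_smul hc, (A.diff_graded j).gradedComponent_mulVec] at this
    have hsucc : firstVars N (j + 1) = firstVars N j ⊔ Ideal.span {X z} := firstVars_succ z
    set c' := gradedComponent (A.shift (j + 1)) (d + (j + 1)) y₀
    refine ⟨c', gradedComponent_idem _ _ _, fun i => ?_, ?_⟩
    -- With `z_i c ≡ d y`, the vector `z_i c' - z_j y` is a cycle modulo the first `j` variables,
    -- hence a boundary; so `z_i c'` is one once `z_j` is also set to zero.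
    · obtain ⟨y, hyi⟩ := hcX i
      obtain ⟨w, hw⟩ := A.exactMod_firstVars (by omega) le_rfl
        ((X i : HomPoly N) • c' - (X z : HomPoly N) • y) fun l => by
          have : (A.diff j).mulVec ((X i : HomPoly N) • c' - (X z : HomPoly N) • y) l =
              X z * ((X i : HomPoly N) • c - (A.diff j).mulVec y) l -
                X i * ((X z : HomPoly N) • c - (A.diff j).mulVec c') l := by
            simp only [Matrix.mulVec_sub, Matrix.mulVec_smul, Pi.sub_apply, Pi.smul_apply,
              smul_eq_mul]
            ring
          rw [this]
          exact sub_mem (Ideal.mul_mem_left _ _ (hyi l)) (Ideal.mul_mem_left _ _ (hy l))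
      refine ⟨w, fun l => ?_⟩
      have : ((X i : HomPoly N) • c' - (A.diff (j + 1)).mulVec w) l =
          ((X i : HomPoly N) • c' - (X z : HomPoly N) • y - (A.diff (j + 1)).mulVec w) l +
            X z * y l := by
        simp only [Pi.sub_apply, Pi.smul_apply, smul_eq_mul]
        ring
      rw [this, hsucc]
      exact add_mem (Ideal.mem_sup_left (hw l)) (Ideal.mem_sup_right
        (Ideal.mul_mem_right _ _ (Ideal.mem_span_singleton_self _)))
    -- If `c' ≡ d y + z_j x`, applying the differential gives `z_j c ≡ z_j d x`; cancelling `z_j`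
    -- makes `c` a boundary, which it is not.
    · rintro ⟨y, hyc⟩
      rw [hsucc] at hyc
      obtain ⟨x, hx⟩ := exists_eq_smul_add_of_mem_sup_span hyc
      refine hcne ⟨x, fun l => mem_firstVars_of_X_mul_mem z ?_⟩
      have h1 := mulVec_mem (A.diff j) hx l
      rw [Matrix.mulVec_sub, Matrix.mulVec_sub, Matrix.mulVec_mulVec, A.diff_mul_diff,
        Matrix.zero_mulVec, sub_zero, Matrix.mulVec_smul] at h1
      have : X z * (c - (A.diff j).mulVec x) l =
          ((X z : HomPoly N) • c - (A.diff j).mulVec c') l +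
            ((A.diff j).mulVec c' - (X z : HomPoly N) • (A.diff j).mulVec x) l := by
        simp only [Pi.sub_apply, Pi.smul_apply, smul_eq_mul]
        ring
      rw [this]
      exact add_mem (hy l) h1

/-- A nonzero element of degree `d` of the socle of `S / J` produces a basis element of degree
`d + N + 1` of the last module of a minimal resolution of `J`. -/
theorem MinimalGradedFreeResolution.exists_shift_of_socle {J : Ideal (HomPoly N)}
    (E : MinimalGradedFreeResolution J) {d : ℕ} {u : HomPoly N} (hu : u.IsHomogeneous d)
    (hX : ∀ i, X i * u ∈ J) (huJ : u ∉ J) : ∃ i, E.shift N i = d + N + 1 := by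
  obtain ⟨c, hc, -, hne⟩ := E.augmented.exists_of_socle (d := d) (c₀ := fun _ => u)
    (gradedComponent_eq_self_iff.2 fun _ _ => ⟨d, Nat.zero_add _, hu⟩)
    (fun i => (E.exists_augmented_mulVec_iff _).2 (hX i))
    (fun h => huJ ((E.exists_augmented_mulVec_iff _).1 h)) le_rfl
  -- The element `c` lies in place `N + 1` of the augmented complex, which is `F_N`. Not being zero
  -- modulo all variables, it has a coordinate with nonzero constant coefficient, whose basis
  -- element has the degree of `c`.
  have : ∃ i, constantCoeff (c i) ≠ 0 := by
    by_contra! h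
    refine hne ⟨0, fun l => ?_⟩
    rw [Matrix.mulVec_zero, sub_zero]
    exact mem_firstVars_iff_constantCoeff.2 (h l)
  obtain ⟨i, hi⟩ := this
  exact ⟨i, eq_of_constantCoeff_ne_zero hc hi⟩

/-! ## Regularity -/

/-- All minimal resolutions have the shifts of a single one, of length at most `N`, so the set is
finite. Boundedness is what makes the integer `sSup` in `regularity` an upper bound. -/
theorem bddAbove_shift_sub (J : Ideal (HomPoly N)) (hJ : J.IsHomogeneous (forms N)) :
    BddAbove {r : ℤ | ∃ (E : MinimalGradedFreeResolution J) (k : ℕ) (i : Fin (E.rank k)),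
      r = (E.shift k i : ℤ) - k} := by
  obtain ⟨R⟩ := nonempty_minimalGradedFreeResolution J hJ
  refine Set.Finite.bddAbove (((Set.finite_range fun p : Σ k : Fin (N + 1), Fin (R.rank k) =>
    (R.shift p.1 p.2 : ℤ) - (p.1 : ℕ))).subset ?_)
  rintro _ ⟨E, k, i, rfl⟩
  have hk : k < N + 1 := by
    by_contra hk
    have h0 := E.rank_eq_zero (k := k) (by omega)
    exact absurd i.2 (by omega)
  obtain ⟨l, hl⟩ := E.exists_shift_eq R k i
  exact ⟨⟨⟨k, hk⟩, l⟩, by simp [hl]⟩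

/-- If a homogeneous ideal `J` is saturated with respect to `z₀` in all large degrees, it is so
in all degrees `≥ reg J`. -/
theorem isSaturatedInDegree_of_regularity_le {J : Ideal (HomPoly N)}
    (hJ : J.IsHomogeneous (forms N)) {D₀ : ℕ} (h : ∀ D, D₀ ≤ D → IsSaturatedInDegree J D) {D : ℕ}
    (hD : regularity J ≤ D) : IsSaturatedInDegree J D := by
  obtain ⟨E⟩ := nonempty_minimalGradedFreeResolution J hJ
  by_cases hle : D₀ ≤ D
  · exact h D hle
  obtain ⟨n, hn⟩ : ∃ n, D₀ = D + n := ⟨D₀ - D, by omega⟩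
  clear hle
  -- Descending induction on the degree, starting from `D₀`.
  induction n generalizing D with
  | zero => exact h D hn.le
  | succ n ih =>
    have ih' := ih (D := D + 1) (by push_cast; omega) (by omega)
    intro g hg k hk
    by_contra hgJ
    -- Each `z_i g` has degree `D + 1`, where saturation is known, so `g` is a socle element. The
    -- resulting shift `D + N + 1` in `F_N` contributes `D + 1` to the regularity, which is at most
    -- `D`.
    obtain ⟨i, hi⟩ := E.exists_shift_of_socle hg (fun i => by
      refine ih' _ (add_comm 1 D ▸ (isHomogeneous_X ℂ i).mul hg) k ?_
      rw [mul_left_comm]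
      exact Ideal.mul_mem_left _ _ hk) hgJ
    have := le_csSup (bddAbove_shift_sub J hJ) ⟨E, N, i, rfl⟩
    rw [← regularity, hi] at this
    push_cast at this
    omega

end DivisionProblem

/-! ### The division theorem -/

theorem theorem1p4 {N m : ℕ} (V : Set (Fin N → ℂ)) (hV : DivisionProblem.IsAlgebraicSet V)
    (F : Fin m → MvPolynomial (Fin N) ℂ) :
    (¬ DivisionProblem.HasAssociatedVarietyAtInfinity V F →
      (∃ β : ℤ, DivisionProblem.IsDegreeBound V F β) ∧
      (V = Set.univ → DivisionProblem.IsDegreeBound V F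
        (DivisionProblem.regularity (DivisionProblem.homogeneousIdeal F)))) ∧
    (DivisionProblem.HasAssociatedVarietyAtInfinity V F →
      ¬ ∃ β : ℤ, DivisionProblem.IsDegreeBound V F β) := by
  open DivisionProblem in
  refine ⟨fun h => ?_, fun h ⟨β, hβ⟩ => h.not_isDegreeBound β hβ⟩
  obtain ⟨D₀, hD₀⟩ := exists_forall_isSaturatedInDegree_divisionIdeal h
  refine ⟨⟨D₀, isDegreeBound_of_isSaturatedInDegree fun D hD => hD₀ D (by exact_mod_cast hD)⟩, ?_⟩
  rintro rfl
  rw [divisionIdeal_univ] at hD₀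
  refine isDegreeBound_of_isSaturatedInDegree fun D hD => ?_
  rw [divisionIdeal_univ]
  exact isSaturatedInDegree_of_regularity_le (homogeneousIdeal_isHomogeneous F) hD₀ hD
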